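/- Let $k$ be a field and let $R$ be a cochain differential graded algebra over $k$ of the form $\cdots\to 0\to k\to 0\to R^2\to R^3\to\cdots$ (so $R^i=0$ for $i<0$, $R^0=k$, $R^1=0$) with $\dim_k H^i(R)<\infty$ for every $i$. For a DG left $R$-module $M$ put $\sup M=\sup\{j\mid H^j(M)\neq 0\}$, $\inf M=\inf\{j\mid H^j(M)\neq0\}$ (with $\sup\varnothing=-\infty$, $\inf\varnothing=\infty$) and $\operatorname{amp}M=\sup M-\inf M$. View $k$ as a DG left $R$-module via the augmentation $R\to R^0=k$, and let $\mu^\ell(M)=\dim_k H^\ell(\operatorname{RHom}_R(k,M))$ be the Bass numbers of $M$. For an integer $g$, the Bass numbers of $M$ are said to have a gap of length $g$ if there is an integer $j$ with $\mu^j(M)\neq 0$, $\mu^\ell(M)=0$ for $j+1\le\ell\le j+g$, and $\mu^{j+g+1}(M)\neq0$. Suppose that $\sup R<\infty$. Let $M$ be a DG left $R$-module with $\dim_k H^j(M)<\infty$ for every $j$ and $H^j(M)=0$ for all sufficiently large $j$. If $g\ge\sup R$ and the Bass numbers of $M$ have a gap of length $g$, then $\operatorname{amp}M\ge g+1$. In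 particular, the Bass numbers of $R$ itself (as a DG left $R$-module) have no gap of any length $g\ge\sup R$. -/

import Mathlib

universe u v w

/-- A (cochain) differential graded algebra over a field `k`: a `ℤ`-graded associative unital
`k`-algebra with a `k`-linear differential of degree `+1` satisfying the Leibniz rule.
`gr i` is the component of cohomological degree `i`. -/
class DGAlgebra (k : Type u) (R : Type v) [Field k] [Ring R] [Algebra k R] where
  gr : ℤ → Submodule k R
  isInternal : DirectSum.IsInternal gr
  one_mem : (1 : R) ∈ gr 0
  mul_mem : ∀ {i j : ℤ} {a b : R}, a ∈ gr i → b ∈ gr j → a * b ∈ gr (i + j)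
  d : R →ₗ[k] R
  d_mem : ∀ {i : ℤ} {a : R}, a ∈ gr i → d a ∈ gr (i + 1)
  d_d : ∀ a : R, d (d a) = 0
  leibniz : ∀ {i : ℤ} {a : R}, a ∈ gr i → ∀ b : R,
    d (a * b) = d a * b + i.negOnePow • (a * d b)

/-- A DG left module over the DG algebra `R`. -/
class DGModule (k : Type u) (R : Type v) (M : Type w) [Field k] [Ring R] [Algebra k R]
    [DGAlgebra k R] [AddCommGroup M] [Module k M] [Module R M] [IsScalarTower k R M] where
  gr : ℤ → Submodule k M
  isInternal : DirectSum.IsInternal gr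
  smul_mem : ∀ {i j : ℤ} {a : R} {x : M}, a ∈ DGAlgebra.gr (k := k) i → x ∈ gr j →
    a • x ∈ gr (i + j)
  d : M →ₗ[k] M
  d_mem : ∀ {i : ℤ} {x : M}, x ∈ gr i → d x ∈ gr (i + 1)
  d_d : ∀ x : M, d (d x) = 0
  leibniz : ∀ {i : ℤ} {a : R}, a ∈ DGAlgebra.gr (k := k) i → ∀ x : M,
    d (a • x) = DGAlgebra.d (k := k) a • x + i.negOnePow • (a • d x)

/-- `R` as a DG left module over itself. -/
instance DGModule.self (k : Type u) (R : Type v) [Field k] [Ring R] [Algebra k R]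
    [DGAlgebra k R] : DGModule k R R where
  gr := DGAlgebra.gr
  isInternal := DGAlgebra.isInternal
  smul_mem := DGAlgebra.mul_mem
  d := DGAlgebra.d
  d_mem := DGAlgebra.d_mem
  d_d := DGAlgebra.d_d
  leibniz := DGAlgebra.leibniz

namespace DG

section Cohomology

/-- The degree `n` cohomology of a graded `k`-vector space with components `gr n` inside `V`
and with differential `d n` on the component `gr n`: the cycles `gr n ∩ ker (d n)` modulo the
boundaries `d (n - 1) (gr (n - 1))`. -/
abbrev GradedCohomology {k : Type u} {V : Type v} [Field k] [AddCommGroup V] [Module k V]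
    (gr : ℤ → Submodule k V) (d : ℤ → V →ₗ[k] V) (n : ℤ) : Type v :=
  ↥(gr n ⊓ LinearMap.ker (d n)) ⧸
    ((gr (n - 1)).map (d (n - 1))).submoduleOf (gr n ⊓ LinearMap.ker (d n))

variable (k : Type u) (R : Type v) (M : Type w) [Field k] [Ring R] [Algebra k R]
  [DGAlgebra k R] [AddCommGroup M] [Module k M] [Module R M] [IsScalarTower k R M]
  [DGModule k R M]

/-- The cohomology `H^j(M)` of a DG module. -/
abbrev Cohomology (j : ℤ) : Type w :=
  GradedCohomology (DGModule.gr (k := k) R (M := M)) (fun _ => DGModule.d R) j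

/-- `M` is locally finite: every `H^j(M)` is finite dimensional over `k`. -/
def LocallyFinite : Prop := ∀ j : ℤ, Module.Finite k (Cohomology k R M j)

/-- `M` belongs to `D^-(R)`: one has `H^j(M) = 0` for `j ≫ 0`. -/
def IsBoundedAbove : Prop := ∃ n : ℤ, ∀ j : ℤ, n < j → Subsingleton (Cohomology k R M j)

/-- `sup M = sup {j | H^j(M) ≠ 0}`, with values in the extended reals. -/
noncomputable def sup : EReal :=
  sSup {x | ∃ j : ℤ, Nontrivial (Cohomology k R M j) ∧ x = ((j : ℝ) : EReal)}

/-- `inf M = inf {j | H^j(M) ≠ 0}`, with values in the extended reals. -/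
noncomputable def inf : EReal :=
  sInf {x | ∃ j : ℤ, Nontrivial (Cohomology k R M j) ∧ x = ((j : ℝ) : EReal)}

/-- `amp M = sup M - inf M`. The convention of `EReal` for `⊤ - ⊤` plays no role: `inf M = ⊤`
only if `H(M) = 0`, and then `amp M = ⊥ - ⊤ = ⊥`. -/
noncomputable def amp : EReal := sup k R M - inf k R M

end Cohomology

/-- The standing assumption on `R`: it has the form `⋯ → 0 → k → 0 → R² → R³ → ⋯`, and all its
cohomology spaces are finite dimensional over `k`. -/
class SimplyConnectedCochain (k : Type u) (R : Type v) [Field k] [Ring R] [Algebra k R]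
    [DGAlgebra k R] : Prop where
  nontrivial : Nontrivial R
  gr_neg : ∀ i : ℤ, i < 0 → DGAlgebra.gr (k := k) (R := R) i = ⊥
  gr_zero : DGAlgebra.gr (k := k) (R := R) 0 = LinearMap.range (Algebra.linearMap k R)
  gr_one : DGAlgebra.gr (k := k) (R := R) 1 = ⊥
  locallyFinite : LocallyFinite k R R

section Hom

variable (k : Type u) (R : Type v) [Field k] [Ring R] [Algebra k R] [DGAlgebra k R]
  (P : Type w) [AddCommGroup P] [Module k P] [Module R P] [IsScalarTower k R P] [DGModule k R P]
  (M : Type*) [AddCommGroup M] [Module k M] [Module R M] [IsScalarTower k R M] [DGModule k R M]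

/-- `Hom_R(P, M)^n`: the `R`-linear maps of degree `n`, with the usual sign
`f (a x) = (-1)^(n |a|) a f(x)`. -/
def homGr (n : ℤ) : Submodule k (P →ₗ[k] M) where
  carrier := {f | (∀ (j : ℤ) (x : P), x ∈ DGModule.gr (k := k) R j →
      f x ∈ DGModule.gr (k := k) R (j + n)) ∧
    ∀ (i : ℤ) (a : R), a ∈ DGAlgebra.gr (k := k) i → ∀ x : P,
      f (a • x) = (n * i).negOnePow • (a • f x)}
  add_mem' := by
    rintro f g ⟨hf, hf'⟩ ⟨hg, hg'⟩
    refine ⟨fun j x hx => Submodule.add_mem _ (hf j x hx) (hg j x hx), fun i a ha x => ?_⟩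
    simp only [LinearMap.add_apply, hf' i a ha, hg' i a ha, smul_add]
  zero_mem' := ⟨fun _ _ _ => Submodule.zero_mem _, fun _ _ _ _ => by simp⟩
  smul_mem' := by
    rintro c f ⟨hf, hf'⟩
    refine ⟨fun j x hx => Submodule.smul_mem _ c (hf j x hx), fun i a ha x => ?_⟩
    simp only [LinearMap.smul_apply, hf' i a ha]
    rw [smul_comm c, ← algebraMap_smul R c (f x), ← algebraMap_smul R c (a • f x), smul_smul,
      smul_smul, Algebra.commutes]

/-- The differential of `Hom_R(P, M)` on maps of degree `n`: `f ↦ d f - (-1)^n f d`. -/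
def homD (n : ℤ) : (P →ₗ[k] M) →ₗ[k] (P →ₗ[k] M) where
  toFun f := DGModule.d R ∘ₗ f - n.negOnePow • (f ∘ₗ DGModule.d R)
  map_add' f g := by
    simp only [LinearMap.comp_add, LinearMap.add_comp, smul_add]
    abel
  map_smul' c f := by
    simp only [LinearMap.comp_smul, LinearMap.smul_comp, RingHom.id_apply, smul_sub]
    rw [smul_comm c]

/-- `H^n(Hom_R(P, M))`. -/
abbrev HomCohomology (n : ℤ) : Type _ :=
  GradedCohomology (homGr k R P M) (homD k R P M) n

/-- `P` is semi-free: it has a homogeneous basis `e` over the underlying graded algebra, and a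
filtration `F(n) = ⊕_{fil x ≤ n} R e_x` such that `d e_x` lies in `F(fil x - 1)`; in particular
`F(n) / F(n - 1)` is a direct sum of shifts of `R`. -/
def IsSemiFree : Prop :=
  ∃ (E : Type w) (e : Module.Basis E R P) (deg : E → ℤ) (fil : E → ℕ),
    (∀ x, e x ∈ DGModule.gr (k := k) R (deg x)) ∧
    ∀ x, DGModule.d (k := k) R (e x) ∈ Submodule.span R (e '' {y | fil y < fil x})

variable {P M} in
/-- A morphism of DG modules. -/
structure IsDGHom (f : P →ₗ[R] M) : Prop where
  map_mem : ∀ (j : ℤ) (x : P), x ∈ DGModule.gr (k := k) R j → f x ∈ DGModule.gr (k := k) R j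
  map_d : ∀ x : P, f (DGModule.d (k := k) R x) = DGModule.d (k := k) R (f x)

variable {P M} in
/-- A quasi-isomorphism: a morphism of DG modules that is surjective and injective on
cohomology. -/
structure IsQuasiIso (f : P →ₗ[R] M) : Prop extends IsDGHom k R f where
  surj : ∀ (j : ℤ) (y : M), y ∈ DGModule.gr (k := k) R j → DGModule.d (k := k) R y = 0 →
    ∃ x ∈ DGModule.gr (k := k) R j, DGModule.d (k := k) R x = (0 : P) ∧
      ∃ z ∈ DGModule.gr (k := k) R (j - 1), y - f x = DGModule.d (k := k) R z
  inj : ∀ (j : ℤ) (x : P), x ∈ DGModule.gr (k := k) R j → DGModule.d (k := k) R x = 0 →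
    (∃ z ∈ DGModule.gr (k := k) R (j - 1), f x = DGModule.d (k := k) R z) →
    ∃ z ∈ DGModule.gr (k := k) R (j - 1), x = DGModule.d (k := k) R z

end Hom

/-! ### A homogeneous basis of `R` -/

section Basis

/-- A homogeneous `k`-basis of `R` such that the differential of each basis element is a linear
combination of basis elements that are cycles. -/
structure AdaptedBasis (k : Type u) (R : Type v) [Field k] [Ring R] [Algebra k R]
    [DGAlgebra k R] where
  ι : Type v
  b : Module.Basis ι k R
  deg : ι → ℤ
  mem : ∀ i, b i ∈ DGAlgebra.gr (k := k) (deg i)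
  repr_eq_zero : ∀ {n : ℤ} {x : R}, x ∈ DGAlgebra.gr (k := k) n → ∀ i, deg i ≠ n →
    b.repr x i = 0
  adapted : ∀ i j, b.repr (DGAlgebra.d (k := k) (b i)) j ≠ 0 → DGAlgebra.d (k := k) (b j) = 0

theorem exists_basis_subspace {k : Type u} {V : Type v} [Field k] [AddCommGroup V] [Module k V]
    (Z : Submodule k V) :
    ∃ (ι : Type v) (b : Module.Basis ι k V), Z ≤ Submodule.span k (b '' {i | b i ∈ Z}) := by
  let z := Module.Basis.ofVectorSpace k Z
  have hli : LinearIndependent k (fun i => (z i : V)) :=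
    z.linearIndependent.map' Z.subtype (Submodule.ker_subtype Z)
  have hs : LinearIndepOn k id (Set.range fun i => (z i : V)) := hli.linearIndepOn_id
  refine ⟨_, Module.Basis.extend hs, ?_⟩
  intro x hx
  have h1 : (⟨x, hx⟩ : Z) ∈ Submodule.span k (Set.range z) := by
    rw [z.span_eq]; trivial
  have h2 : x ∈ (Submodule.span k (Set.range z)).map Z.subtype := ⟨_, h1, rfl⟩
  rw [Submodule.map_span] at h2
  refine Submodule.span_mono ?_ h2
  rintro _ ⟨_, ⟨i, rfl⟩, rfl⟩
  refine ⟨⟨(z i : V), Module.Basis.subset_extend hs ⟨i, rfl⟩⟩, ?_, ?_⟩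
  · simp [Module.Basis.extend_apply_self]
  · simp [Module.Basis.extend_apply_self]

variable (k : Type u) (R : Type v) [Field k] [Ring R] [Algebra k R] [DGAlgebra k R]

theorem exists_adaptedBasis : Nonempty (AdaptedBasis k R) := by
  have hint := DGAlgebra.isInternal (k := k) (R := R)
  let Z : ∀ n : ℤ, Submodule k (DGAlgebra.gr (k := k) (R := R) n) := fun n =>
    (LinearMap.ker (DGAlgebra.d (k := k) (R := R))).comap (Submodule.subtype _)
  choose ι v hv using fun n : ℤ => exists_basis_subspace (Z n)
  refine ⟨⟨(n : ℤ) × ι n, hint.collectedBasis v, Sigma.fst, hint.collectedBasis_mem v, ?_, ?_⟩⟩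
  · rintro n x hx ⟨m, a⟩ hne
    exact hint.collectedBasis_repr_of_mem_ne v (Ne.symm hne) hx
  · rintro ⟨n, a⟩ j hj
    let B := hint.collectedBasis v
    have hBc : ∀ n a, B ⟨n, a⟩ = (v n a : R) := fun n a => by
      simp [B, DirectSum.IsInternal.collectedBasis_coe]
    have hmem : DGAlgebra.d (k := k) (B ⟨n, a⟩) ∈
        Submodule.span k (B '' {j | DGAlgebra.d (k := k) (B j) = 0}) := by
      have h0 : DGAlgebra.d (k := k) (B ⟨n, a⟩) ∈ DGAlgebra.gr (k := k) (R := R) (n + 1) :=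
        DGAlgebra.d_mem (hint.collectedBasis_mem v ⟨n, a⟩)
      have h1 : (⟨_, h0⟩ : DGAlgebra.gr (k := k) (R := R) (n + 1)) ∈ Z (n + 1) := by
        simp [Z, DGAlgebra.d_d]
      have h2 := Submodule.mem_map_of_mem (f := Submodule.subtype _) (hv (n + 1) h1)
      rw [Submodule.map_span] at h2
      refine Submodule.span_mono ?_ h2
      rintro _ ⟨_, ⟨i, hi, rfl⟩, rfl⟩
      refine ⟨⟨n + 1, i⟩, ?_, hBc _ _⟩
      have : DGAlgebra.d (k := k) (v (n + 1) i : R) = 0 := by simpa [Z] using hi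
      simpa [hBc] using this
    have := Module.Basis.repr_support_subset_of_mem_span B _ hmem
    exact this (by simpa [B] using hj)

variable {k R}

theorem AdaptedBasis.mem_gr_iff (β : AdaptedBasis k R) {n : ℤ} {x : R} :
    x ∈ DGAlgebra.gr (k := k) n ↔ ∀ i, β.deg i ≠ n → β.b.repr x i = 0 := by
  refine ⟨fun hx i hi => β.repr_eq_zero hx i hi, fun h => ?_⟩
  rw [← β.b.linearCombination_repr x, Finsupp.linearCombination_apply]
  refine Submodule.sum_mem _ fun i _ => ?_
  by_cases hi : β.deg i = n
  · exact Submodule.smul_mem _ _ (hi ▸ β.mem i)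
  · simp [h i hi]

/-- A grading that is spanned by a homogeneous basis is an internal direct sum. -/
theorem isInternal_of_basis {k : Type u} {V : Type v} {ι : Type*} [Field k] [AddCommGroup V]
    [Module k V] (b : Module.Basis ι k V) (deg : ι → ℤ) (gr : ℤ → Submodule k V)
    (h : ∀ n x, x ∈ gr n ↔ ∀ i, deg i ≠ n → b.repr x i = 0) : DirectSum.IsInternal gr := by
  rw [DirectSum.isInternal_submodule_iff_iSupIndep_and_iSup_eq_top]
  constructor
  · rw [iSupIndep_iff_finsetSum_eq_zero_imp_eq_zero]
    intro s x hx hsum n hn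
    apply b.repr.injective
    ext i
    rw [map_zero, Finsupp.zero_apply]
    by_cases hi : deg i = n
    · have h1 : ∑ m ∈ s, b.repr (x m) i = 0 := by
        have := congrArg (fun y => b.repr y i) hsum
        simpa [map_sum, Finsupp.finsetSum_apply] using this
      rw [Finset.sum_eq_single n] at h1
      · exact h1
      · intro m hm hmn
        exact (h m _).1 (hx m hm) i (fun h' => hmn (h'.symm.trans hi))
      · exact fun h' => absurd hn h'
    · exact (h n _).1 (hx n hn) i hi
  · rw [eq_top_iff, ← b.span_eq, Submodule.span_le]
    rintro _ ⟨i, rfl⟩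
    refine Submodule.mem_iSup_of_mem (deg i) ((h _ _).2 fun j hj => ?_)
    rw [b.repr_self, Finsupp.single_eq_of_ne]
    rintro rfl
    exact hj rfl

theorem d_one : DGAlgebra.d (k := k) (1 : R) = 0 := by
  have := DGAlgebra.leibniz (k := k) (R := R) DGAlgebra.one_mem 1
  simpa using this

theorem d_algebraMap (c : k) : DGAlgebra.d (k := k) (algebraMap k R c) = 0 := by
  rw [Algebra.algebraMap_eq_smul_one, map_smul, d_one, smul_zero]

end Basis

/-! ### The augmentation `R → k` and the DG module `k` -/

section Augmentation

variable (k : Type u) (R : Type v) [Field k] [Ring R] [Algebra k R] [DGAlgebra k R]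
  [hR : SimplyConnectedCochain k R]

theorem exists_augmentation :
    ∃ ε : R →ₐ[k] k, ∀ (n : ℤ) (x : R), n ≠ 0 → x ∈ DGAlgebra.gr (k := k) n → ε x = 0 := by
  obtain ⟨β⟩ := exists_adaptedBasis k R
  have hnt := hR.nontrivial
  have hc : ∀ i, β.deg i = 0 → ∃ c : k, algebraMap k R c = β.b i := by
    intro i hi
    have := β.mem i
    rw [hi, hR.gr_zero] at this
    exact this
  choose c hc using hc
  have hdeg : ∀ i, 0 ≤ β.deg i := by
    intro i
    by_contra h
    have := β.mem i
    rw [hR.gr_neg _ (not_le.1 h), Submodule.mem_bot] at this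
    exact β.b.ne_zero i this
  let e : R →ₗ[k] k := β.b.constr k fun i => if h : β.deg i = 0 then c i h else 0
  have he : ∀ i, e (β.b i) = if h : β.deg i = 0 then c i h else 0 := fun i =>
    β.b.constr_basis k _ i
  have hvan : ∀ (n : ℤ) (x : R), n ≠ 0 → x ∈ DGAlgebra.gr (k := k) n → e x = 0 := by
    intro n x hn hx
    rw [← β.b.linearCombination_repr x, Finsupp.linearCombination_apply, map_finsuppSum]
    refine Finset.sum_eq_zero fun i _ => ?_
    by_cases hi : β.deg i = n
    · simp [he, hi, hn]
    · simp [β.repr_eq_zero hx i hi]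
  have halg : ∀ a : k, e (algebraMap k R a) = a := by
    intro a
    by_cases hex : ∃ i, β.deg i = 0
    · obtain ⟨i, hi⟩ := hex
      have hci : c i hi ≠ 0 := by
        intro h0
        have := hc i hi
        rw [h0, map_zero] at this
        exact β.b.ne_zero i this.symm
      have : algebraMap k R a = (a * (c i hi)⁻¹) • β.b i := by
        rw [← hc i hi, Algebra.smul_def, ← map_mul, mul_assoc, inv_mul_cancel₀ hci, mul_one]
      rw [this, map_smul, he, dif_pos hi, smul_eq_mul, mul_assoc, inv_mul_cancel₀ hci, mul_one]
    · exfalso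
      push Not at hex
      have h1 : (1 : R) = 0 := by
        apply β.b.repr.injective
        ext i
        simpa using β.repr_eq_zero (DGAlgebra.one_mem (k := k) (R := R)) i (hex i)
      exact one_ne_zero h1
  refine ⟨AlgHom.ofLinearMap e (by simpa using halg 1) ?_, hvan⟩
  intro x y
  have hmul : (LinearMap.mul k R).compr₂ e = (LinearMap.mul k k).compl₁₂ e e := by
    refine β.b.ext fun i => β.b.ext fun j => ?_
    simp only [LinearMap.compr₂_apply, LinearMap.mul_apply', LinearMap.compl₁₂_apply]
    by_cases hi : β.deg i = 0
    · rw [he i, dif_pos hi, ← hc i hi, ← Algebra.smul_def, map_smul, smul_eq_mul]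
    · rw [he i, dif_neg hi, zero_mul]
      have hi' := hdeg i
      have hj' := hdeg j
      exact hvan _ _ (by omega) (DGAlgebra.mul_mem (β.mem i) (β.mem j))
  exact LinearMap.congr_fun (LinearMap.congr_fun hmul x) y

/-- The augmentation `R → k`: the algebra homomorphism that vanishes in non-zero degrees. -/
noncomputable def augmentation : R →ₐ[k] k := (exists_augmentation k R).choose

theorem augmentation_of_mem {n : ℤ} {x : R} (hn : n ≠ 0) (hx : x ∈ DGAlgebra.gr (k := k) n) :
    augmentation k R x = 0 :=
  (exists_augmentation k R).choose_spec n x hn hx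

variable {R} in
theorem algebraMap_augmentation {x : R} (hx : x ∈ DGAlgebra.gr (k := k) 0) :
    algebraMap k R (augmentation k R x) = x := by
  rw [hR.gr_zero] at hx
  obtain ⟨c, rfl⟩ := hx
  simp

/-- The field `k`, viewed as a DG left `R`-module concentrated in degree zero, on which `R` acts
through the augmentation. -/
def Residue (k : Type u) (R : Type v) [Field k] [Ring R] [Algebra k R] [DGAlgebra k R]
    [SimplyConnectedCochain k R] : Type u := k

namespace Residue

instance : AddCommGroup (Residue k R) := inferInstanceAs (AddCommGroup k)

instance : Module k (Residue k R) := inferInstanceAs (Module k k)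

noncomputable instance : Module R (Residue k R) := Module.compHom k (augmentation k R).toRingHom

/-- The element `c` of `k`, as an element of the DG module `k`. -/
def of (c : k) : Residue k R := c

theorem smul_def (a : R) (x : Residue k R) : a • x = augmentation k R a • x := rfl

instance : IsScalarTower k R (Residue k R) :=
  ⟨fun c a x => by rw [smul_def, smul_def, map_smul, smul_assoc]⟩

noncomputable instance : DGModule k R (Residue k R) where
  gr n := if n = 0 then ⊤ else ⊥
  isInternal := by
    let b : Module.Basis Unit k (Residue k R) :=
      (Module.Basis.singleton Unit k : Module.Basis Unit k k)
    refine isInternal_of_basis b (fun _ => 0) _ fun n x => ?_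
    by_cases hn : n = 0
    · rw [if_pos hn]
      exact ⟨fun _ i hi => absurd hn.symm hi, fun _ => Submodule.mem_top⟩
    · rw [if_neg hn, Submodule.mem_bot]
      refine ⟨fun hx i _ => by rw [hx, LinearEquiv.map_zero]; rfl, fun h => ?_⟩
      refine (LinearEquiv.map_eq_zero_iff b.repr).1 (Finsupp.ext fun i => ?_)
      exact h i (Ne.symm hn)
  smul_mem := by
    intro i j a x ha hx
    by_cases hj : j = 0
    · by_cases hi : i = 0
      · simp [hi, hj]
      · rw [smul_def, augmentation_of_mem k R hi ha, zero_smul]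
        exact Submodule.zero_mem _
    · rw [if_neg hj, Submodule.mem_bot] at hx
      rw [hx, smul_zero]
      exact Submodule.zero_mem _
  d := 0
  d_mem _ := Submodule.zero_mem _
  d_d _ := rfl
  leibniz := by
    intro i a ha x
    have : augmentation k R (DGAlgebra.d (k := k) a) = 0 := by
      by_cases hi : i + 1 = 0
      · have : i < 0 := by omega
        rw [hR.gr_neg i this, Submodule.mem_bot] at ha
        simp [ha]
      · exact augmentation_of_mem k R hi (DGAlgebra.d_mem ha)
    simp [smul_def, this]

end Residue

theorem augmentation_d (a : R) : augmentation k R (DGAlgebra.d (k := k) a) = 0 := by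
  obtain ⟨β⟩ := exists_adaptedBasis k R
  have : (augmentation k R).toLinearMap ∘ₗ DGAlgebra.d (k := k) = 0 := by
    refine β.b.ext fun i => ?_
    have ha := β.mem i
    by_cases hi : β.deg i + 1 = 0
    · have : β.deg i < 0 := by omega
      rw [hR.gr_neg _ this, Submodule.mem_bot] at ha
      simp [ha]
    · exact augmentation_of_mem k R hi (DGAlgebra.d_mem ha)
  exact LinearMap.congr_fun this a

end Augmentation

/-! ### The bar resolution of `k` -/

namespace AdaptedBasis

variable {k : Type u} {R : Type v} [Field k] [Ring R] [Algebra k R] [DGAlgebra k R]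
  (β : AdaptedBasis k R)

/-- The basis elements of non-zero degree. -/
abbrev Letter : Type v := {i : β.ι // β.deg i ≠ 0}

/-- The underlying `R`-module of the normalized bar resolution of `k`: the free module on the
words `[b₁ | ⋯ | bₙ]` in the letters. The basis element `[w]` is `Finsupp.single w 1`. -/
abbrev Bar : Type v := List β.Letter →₀ R

/-- The degree of a word: each letter `b` contributes `|b| - 1`. -/
def wordDeg (w : List β.Letter) : ℤ := (w.map fun i => β.deg i.1 - 1).sum

@[simp] theorem wordDeg_nil : β.wordDeg [] = 0 := rfl

@[simp] theorem wordDeg_cons (i : β.Letter) (w : List β.Letter) :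
    β.wordDeg (i :: w) = β.deg i.1 - 1 + β.wordDeg w := by simp [wordDeg]

/-- The sign involution `a ↦ (-1)^|a| a` of `R`. -/
noncomputable def sign : R →ₗ[k] R := β.b.constr k fun i => (β.deg i).negOnePow • β.b i

open Classical in
/-- The map `r ↦ [r | w]`, which kills the elements of degree zero. -/
noncomputable def consWord (w : List β.Letter) : R →ₗ[k] β.Bar :=
  β.b.constr k fun i => if h : β.deg i ≠ 0 then Finsupp.single (⟨i, h⟩ :: w) 1 else 0

/-- The `k`-linear contraction `r [w] ↦ [r | w]`. -/
noncomputable def contr : β.Bar →ₗ[k] β.Bar := Finsupp.lsum k β.consWord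

/-- The differential of the basis element `[w]`. It is the usual bar differential, determined
recursively by `[] ↦ 0` and by `d [b | w] = b [w] - s (d (b [w]))`, where `s` is the
contraction. -/
noncomputable def dWord : List β.Letter → β.Bar
  | [] => 0
  | i :: w => Finsupp.single w (β.b i.1) -
      β.contr (Finsupp.single w (DGAlgebra.d (k := k) (β.b i.1)) +
        (β.deg i.1).negOnePow • (β.b i.1 • dWord w))

/-- The differential of the bar resolution: `d (r [w]) = d(r) [w] + (-1)^|r| r d[w]`. -/
noncomputable def barD : β.Bar →ₗ[k] β.Bar :=
  Finsupp.lsum k fun w => Finsupp.lsingle w ∘ₗ DGAlgebra.d (k := k) +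
    ((LinearMap.toSpanSingleton R β.Bar (β.dWord w)).restrictScalars k) ∘ₗ β.sign

/-- The grading of the bar resolution: `r [w]` has degree `|r| + |w|`. -/
def barGr (n : ℤ) : Submodule k β.Bar where
  carrier := {x | ∀ w, x w ∈ DGAlgebra.gr (k := k) (n - β.wordDeg w)}
  add_mem' hx hy w := Submodule.add_mem _ (hx w) (hy w)
  zero_mem' _ := Submodule.zero_mem _
  smul_mem' c _ hx w := Submodule.smul_mem _ c (hx w)

theorem mem_barGr {n : ℤ} {x : β.Bar} :
    x ∈ β.barGr n ↔ ∀ w, x w ∈ DGAlgebra.gr (k := k) (n - β.wordDeg w) := Iff.rfl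

theorem single_mem_barGr {m n : ℤ} {r : R} (w : List β.Letter)
    (hr : r ∈ DGAlgebra.gr (k := k) m) (h : m + β.wordDeg w = n) :
    Finsupp.single w r ∈ β.barGr n := by
  classical
  intro v
  by_cases hv : v = w
  · subst hv
    rw [Finsupp.single_eq_same, ← h, add_sub_cancel_right]
    exact hr
  · rw [Finsupp.single_eq_of_ne hv]
    exact Submodule.zero_mem _

/-- A `k`-linear map sends `barGr m` to a submodule as soon as it does so on the `r [w]`. -/
theorem map_barGr {V : Type*} [AddCommGroup V] [Module k V] (f : β.Bar →ₗ[k] V)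
    (S : Submodule k V) (m : ℤ)
    (h : ∀ w i, β.deg i + β.wordDeg w = m → f (Finsupp.single w (β.b i)) ∈ S)
    {x : β.Bar} (hx : x ∈ β.barGr m) : f x ∈ S := by
  rw [← x.sum_single, map_finsuppSum]
  refine Submodule.sum_mem _ fun w _ => ?_
  have hx' := hx w
  generalize x w = r at hx'
  have : f (Finsupp.single w r) = (f ∘ₗ Finsupp.lsingle w) r := rfl
  dsimp only
  rw [this, ← β.b.linearCombination_repr r, Finsupp.linearCombination_apply, map_finsuppSum]
  refine Submodule.sum_mem _ fun i _ => ?_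
  dsimp only
  rw [map_smul]
  by_cases hi : β.deg i = m - β.wordDeg w
  · exact Submodule.smul_mem _ _ (h w i (by omega))
  · rw [β.repr_eq_zero hx' i hi, zero_smul]
    exact Submodule.zero_mem _

/-- Two `k`-linear maps on the bar resolution agree if they agree on the `b [w]`. -/
theorem bar_ext {V : Type*} [AddCommGroup V] [Module k V] {f g : β.Bar →ₗ[k] V}
    (h : ∀ w i, f (Finsupp.single w (β.b i)) = g (Finsupp.single w (β.b i))) : f = g :=
  Finsupp.lhom_ext' fun w => β.b.ext fun i => h w i

theorem sign_b (i : β.ι) : β.sign (β.b i) = (β.deg i).negOnePow • β.b i :=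
  β.b.constr_basis k _ i

theorem sign_of_mem {n : ℤ} {r : R} (hr : r ∈ DGAlgebra.gr (k := k) n) :
    β.sign r = n.negOnePow • r := by
  conv_lhs => rw [← β.b.linearCombination_repr r]
  conv_rhs => rw [← β.b.linearCombination_repr r]
  rw [Finsupp.linearCombination_apply, map_finsuppSum, Finsupp.sum, Finsupp.sum,
    Finset.smul_sum]
  refine Finset.sum_congr rfl fun i _ => ?_
  by_cases hi : β.deg i = n
  · rw [map_smul, sign_b, hi, smul_comm]
  · simp [β.repr_eq_zero hr i hi]

theorem sign_mul {n : ℤ} {a : R} (ha : a ∈ DGAlgebra.gr (k := k) n) (r : R) :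
    β.sign (a * r) = n.negOnePow • (a * β.sign r) := by
  have : β.sign ∘ₗ LinearMap.mulLeft k a =
      n.negOnePow • (LinearMap.mulLeft k a ∘ₗ β.sign) := by
    refine β.b.ext fun i => ?_
    simp only [LinearMap.comp_apply, LinearMap.mulLeft_apply, LinearMap.smul_apply]
    rw [β.sign_of_mem (DGAlgebra.mul_mem ha (β.mem i)), sign_b, Int.negOnePow_add, mul_smul,
      mul_smul_comm]
  exact LinearMap.congr_fun this r

theorem consWord_b (w : List β.Letter) {i : β.ι} (hi : β.deg i ≠ 0) :
    β.consWord w (β.b i) = Finsupp.single (⟨i, hi⟩ :: w) 1 := by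
  rw [consWord, β.b.constr_basis, dif_pos hi]

theorem consWord_b_zero (w : List β.Letter) {i : β.ι} (hi : β.deg i = 0) :
    β.consWord w (β.b i) = 0 := by
  rw [consWord, β.b.constr_basis, dif_neg (not_not.2 hi)]

theorem consWord_of_mem (w : List β.Letter) {r : R} (hr : r ∈ DGAlgebra.gr (k := k) 0) :
    β.consWord w r = 0 := by
  rw [← β.b.linearCombination_repr r, Finsupp.linearCombination_apply, map_finsuppSum]
  refine Finset.sum_eq_zero fun i _ => ?_
  by_cases hi : β.deg i = 0
  · simp [β.consWord_b_zero w hi]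
  · simp [β.repr_eq_zero hr i hi]

theorem contr_single (w : List β.Letter) (r : R) :
    β.contr (Finsupp.single w r) = β.consWord w r := by
  rw [contr, Finsupp.lsum_single]

theorem contr_contr (x : β.Bar) : β.contr (β.contr x) = 0 := by
  have : β.contr ∘ₗ β.contr = 0 := by
    refine β.bar_ext fun w i => ?_
    rw [LinearMap.comp_apply, contr_single]
    by_cases hi : β.deg i = 0
    · simp [β.consWord_b_zero w hi]
    · rw [β.consWord_b w hi, contr_single, β.consWord_of_mem _ DGAlgebra.one_mem]
      rfl
  exact LinearMap.congr_fun this x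

theorem contr_mem {n : ℤ} {x : β.Bar} (hx : x ∈ β.barGr n) : β.contr x ∈ β.barGr (n - 1) := by
  refine β.map_barGr β.contr _ n (fun w i h => ?_) hx
  rw [contr_single]
  by_cases hi : β.deg i = 0
  · rw [β.consWord_b_zero w hi]
    exact Submodule.zero_mem _
  · rw [β.consWord_b w hi]
    refine β.single_mem_barGr _ DGAlgebra.one_mem ?_
    rw [wordDeg_cons]
    dsimp only
    omega

theorem smul_mem_barGr {i j : ℤ} {a : R} {x : β.Bar} (ha : a ∈ DGAlgebra.gr (k := k) i)
    (hx : x ∈ β.barGr j) : a • x ∈ β.barGr (i + j) := by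
  intro w
  have := DGAlgebra.mul_mem ha (hx w)
  rw [add_sub_assoc]
  exact this

theorem units_smul_mem {V : Type*} [AddCommGroup V] [Module k V] (S : Submodule k V) (n : ℤ)
    {x : V} (hx : x ∈ S) : n.negOnePow • x ∈ S := by
  rcases Int.units_eq_one_or n.negOnePow with h | h <;> rw [h]
  · simpa using hx
  · simpa using S.neg_mem hx

theorem dWord_mem (w : List β.Letter) : β.dWord w ∈ β.barGr (β.wordDeg w + 1) := by
  induction w with
  | nil => exact Submodule.zero_mem _
  | cons i w ih =>
    rw [dWord, wordDeg_cons]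
    refine Submodule.sub_mem _ (β.single_mem_barGr w (β.mem i.1) (by omega)) ?_
    have : β.deg i.1 - 1 + β.wordDeg w + 1 = (β.deg i.1 + 1 + β.wordDeg w) - 1 := by omega
    rw [this]
    refine β.contr_mem (Submodule.add_mem _ (β.single_mem_barGr w (DGAlgebra.d_mem (β.mem i.1))
      rfl) (units_smul_mem _ _ ?_))
    have h2 := β.smul_mem_barGr (β.mem i.1) ih
    rwa [show β.deg i.1 + (β.wordDeg w + 1) = β.deg i.1 + 1 + β.wordDeg w by omega] at h2

theorem barD_single (w : List β.Letter) (r : R) :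
    β.barD (Finsupp.single w r) =
      Finsupp.single w (DGAlgebra.d (k := k) r) + β.sign r • β.dWord w := by
  rw [barD, Finsupp.lsum_single]
  rfl

theorem barD_single_of_mem (w : List β.Letter) {n : ℤ} {r : R}
    (hr : r ∈ DGAlgebra.gr (k := k) n) :
    β.barD (Finsupp.single w r) =
      Finsupp.single w (DGAlgebra.d (k := k) r) + n.negOnePow • (r • β.dWord w) := by
  rw [barD_single, β.sign_of_mem hr, smul_assoc]

theorem barD_single_one (w : List β.Letter) : β.barD (Finsupp.single w 1) = β.dWord w := by
  rw [β.barD_single_of_mem w DGAlgebra.one_mem, d_one]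
  simp

theorem barD_mem {n : ℤ} {x : β.Bar} (hx : x ∈ β.barGr n) : β.barD x ∈ β.barGr (n + 1) := by
  refine β.map_barGr β.barD _ n (fun w i h => ?_) hx
  rw [β.barD_single_of_mem w (β.mem i)]
  refine Submodule.add_mem _ (β.single_mem_barGr w (DGAlgebra.d_mem (β.mem i)) (by omega))
    (units_smul_mem _ _ ?_)
  have h2 := β.smul_mem_barGr (β.mem i) (β.dWord_mem w)
  rwa [show β.deg i + (β.wordDeg w + 1) = n + 1 by omega] at h2

theorem barD_smul {n : ℤ} {a : R} (ha : a ∈ DGAlgebra.gr (k := k) n) (x : β.Bar) :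
    β.barD (a • x) = DGAlgebra.d (k := k) a • x + n.negOnePow • (a • β.barD x) := by
  induction x using Finsupp.induction_linear with
  | zero => simp
  | add x y hx hy =>
    rw [smul_add, map_add, hx, hy, map_add, smul_add, smul_add, smul_add]
    abel
  | single w r =>
    rw [Finsupp.smul_single, smul_eq_mul, barD_single, barD_single, DGAlgebra.leibniz ha,
      β.sign_mul ha, Finsupp.single_add, smul_add, smul_add, Finsupp.smul_single,
      Finsupp.smul_single, smul_assoc, mul_smul, Finsupp.smul_single, smul_eq_mul, smul_eq_mul]
    abel

theorem barD_barD_smul {n : ℤ} {a : R} (ha : a ∈ DGAlgebra.gr (k := k) n) (x : β.Bar) :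
    β.barD (β.barD (a • x)) = a • β.barD (β.barD x) := by
  have hsm : ∀ (m : ℤ) (y : β.Bar), β.barD (m.negOnePow • y) = m.negOnePow • β.barD y := by
    intro m y
    rcases Int.units_eq_one_or m.negOnePow with h | h <;> simp [h]
  rw [β.barD_smul ha, map_add, hsm, β.barD_smul (DGAlgebra.d_mem ha), DGAlgebra.d_d,
    β.barD_smul ha, zero_smul, Int.negOnePow_succ, zero_add, smul_add, smul_smul]
  rcases Int.units_eq_one_or n.negOnePow with h | h <;> simp [h]

variable [hR : SimplyConnectedCochain k R]

theorem dWord_nil_apply (w : List β.Letter) : augmentation k R (β.dWord w []) = 0 := by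
  have hs : ∀ x : β.Bar, β.contr x [] = 0 := by
    intro x
    have : (Finsupp.lapply [] : β.Bar →ₗ[k] R) ∘ₗ β.contr = 0 := by
      refine β.bar_ext fun w i => ?_
      rw [LinearMap.comp_apply, contr_single]
      by_cases hi : β.deg i = 0
      · simp [β.consWord_b_zero w hi]
      · simp [β.consWord_b w hi]
    exact LinearMap.congr_fun this x
  cases w with
  | nil => simp [dWord]
  | cons i w =>
    rw [dWord, Finsupp.sub_apply, hs, sub_zero]
    cases w with
    | nil => simpa using augmentation_of_mem k R i.2 (β.mem i.1)
    | cons j w => simp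

theorem augmentation_barD (x : β.Bar) : augmentation k R (β.barD x []) = 0 := by
  induction x using Finsupp.induction_linear with
  | zero => simp
  | add x y hx hy => rw [map_add, Finsupp.add_apply, map_add, hx, hy, add_zero]
  | single w r =>
    rw [barD_single, Finsupp.add_apply, map_add, Finsupp.smul_apply, smul_eq_mul, map_mul,
      dWord_nil_apply, mul_zero, add_zero]
    cases w with
    | nil => simpa using augmentation_d k R r
    | cons j w => simp

/-- The contraction `s` is a homotopy between the identity and the projection on `k []`. -/
theorem barD_contr (x : β.Bar) : β.barD (β.contr x) + β.contr (β.barD x) =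
    x - Finsupp.single [] (algebraMap k R (augmentation k R (x []))) := by
  have key : β.barD ∘ₗ β.contr + β.contr ∘ₗ β.barD = LinearMap.id -
      (Finsupp.lsingle [] : R →ₗ[k] β.Bar) ∘ₗ Algebra.linearMap k R ∘ₗ
        (augmentation k R).toLinearMap ∘ₗ (Finsupp.lapply [] : β.Bar →ₗ[k] R) := by
    refine β.bar_ext fun w i => ?_
    simp only [LinearMap.add_apply, LinearMap.comp_apply, LinearMap.sub_apply, LinearMap.id_apply,
      Finsupp.lsingle_apply, Finsupp.lapply_apply, Algebra.linearMap_apply,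
      AlgHom.toLinearMap_apply]
    by_cases hi : β.deg i = 0
    · have hb := β.mem i
      rw [hi] at hb
      rw [contr_single, β.consWord_b_zero w hi, map_zero, zero_add, β.barD_single_of_mem w hb]
      have hb' := algebraMap_augmentation (k := k) hb
      cases w with
      | nil =>
        rw [Finsupp.single_eq_same, hb', ← hb', d_algebraMap]
        simp [dWord]
      | cons j w =>
        have h0 : (Finsupp.single (j :: w) (β.b i) : β.Bar) [] = 0 := by simp
        have h1 : β.contr (β.dWord (j :: w)) = Finsupp.single (j :: w) 1 := by
          rw [dWord, map_sub, contr_contr, sub_zero, contr_single, β.consWord_b w j.2]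
        rw [h0, map_zero, map_zero, Finsupp.single_zero, sub_zero, ← hb', d_algebraMap,
          Finsupp.single_zero, zero_add, Int.negOnePow_zero, one_smul, algebraMap_smul, map_smul,
          h1, Finsupp.smul_single, ← Algebra.algebraMap_eq_smul_one]
    · have h0 : augmentation k R ((Finsupp.single w (β.b i) : β.Bar) []) = 0 := by
        cases w with
        | nil => simpa using augmentation_of_mem k R hi (β.mem i)
        | cons j w => simp
      rw [h0, map_zero, Finsupp.single_zero, sub_zero, contr_single, β.consWord_b w hi,
        barD_single_one, dWord, ← β.barD_single_of_mem w (β.mem i), sub_add_cancel]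
  exact LinearMap.congr_fun key x

theorem barD_barD (x : β.Bar) : β.barD (β.barD x) = 0 := by
  have step : ∀ w, β.barD (β.dWord w) = 0 → ∀ i,
      β.barD (β.barD (Finsupp.single w (β.b i))) = 0 := by
    intro w hw i
    have : (Finsupp.single w (β.b i) : β.Bar) = β.b i • Finsupp.single w 1 := by simp
    rw [this, β.barD_barD_smul (β.mem i), barD_single_one, hw, smul_zero]
  have hword : ∀ w, β.barD (β.dWord w) = 0 := by
    intro w
    induction w with
    | nil => simp [dWord]
    | cons i w ih =>
      have h := β.barD_contr (β.barD (Finsupp.single w (β.b i.1)))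
      rw [step w ih, augmentation_barD, map_zero, map_zero, Finsupp.single_zero, sub_zero,
        add_zero] at h
      rw [dWord, ← β.barD_single_of_mem w (β.mem i.1), map_sub, h, sub_self]
  have : β.barD ∘ₗ β.barD = 0 := β.bar_ext fun w i => step w (hword w) i
  exact LinearMap.congr_fun this x

/-- The bar resolution as a DG left `R`-module. -/
noncomputable instance barDGModule : DGModule k R β.Bar where
  gr := β.barGr
  isInternal := by
    refine isInternal_of_basis (Finsupp.basis fun _ : List β.Letter => β.b)
      (fun p => β.deg p.2 + β.wordDeg p.1) _ fun n x => ?_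
    simp only [mem_barGr, Finsupp.basis_repr, β.mem_gr_iff]
    constructor
    · rintro h ⟨w, i⟩ hi
      exact h w i (by dsimp only at hi; omega)
    · intro h w i hi
      exact h ⟨w, i⟩ (by dsimp only; omega)
  smul_mem := β.smul_mem_barGr
  d := β.barD
  d_mem := β.barD_mem
  d_d := β.barD_barD
  leibniz := β.barD_smul

/-- The augmentation of the bar resolution: `r [] ↦ ε(r)`, and `r [w] ↦ 0` for `w ≠ []`. -/
noncomputable def barAug : β.Bar →ₗ[R] Residue k R :=
  LinearMap.toSpanSingleton R (Residue k R) (Residue.of k R 1) ∘ₗ Finsupp.lapply []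

theorem barAug_apply (x : β.Bar) : β.barAug x = Residue.of k R (augmentation k R (x [])) :=
  (mul_one (augmentation k R (x [])) : _)

/-- The weight of a word, giving the semi-free filtration. -/
noncomputable def weight (w : List β.Letter) : ℕ :=
  open Classical in (w.map fun i => if DGAlgebra.d (k := k) (β.b i.1) = 0 then 2 else 3).sum

theorem dWord_weight (w v : List β.Letter) :
    (β.weight w ≤ β.weight v → β.dWord w v = 0) ∧
      (β.weight w < β.weight v + 2 → β.dWord w v ∈ DGAlgebra.gr (k := k) 0) := by
  classical
  let F : ℕ → Submodule k β.Bar := fun n =>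
    { carrier := {x | ∀ v, (n ≤ β.weight v → x v = 0) ∧
        (n < β.weight v + 2 → x v ∈ DGAlgebra.gr (k := k) 0)}
      add_mem' := fun hx hy v => ⟨fun h => by simp [(hx v).1 h, (hy v).1 h],
        fun h => Submodule.add_mem _ ((hx v).2 h) ((hy v).2 h)⟩
      zero_mem' := fun v => ⟨fun _ => rfl, fun _ => Submodule.zero_mem _⟩
      smul_mem' := fun c x hx v => ⟨fun h => by simp [(hx v).1 h],
        fun h => Submodule.smul_mem _ c ((hx v).2 h)⟩ }
  have hcons : ∀ (i : β.Letter) (w : List β.Letter), β.weight (i :: w) =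
      (if DGAlgebra.d (k := k) (β.b i.1) = 0 then 2 else 3) + β.weight w := by
    intro i w
    simp only [weight, List.map_cons, List.sum_cons]
  have hone : ∀ (n : ℕ) (w : List β.Letter), β.weight w < n →
      (Finsupp.single w 1 : β.Bar) ∈ F n := by
    intro n w hw v
    by_cases hv : v = w
    · subst hv
      refine ⟨fun h => absurd hw (not_lt.2 h), fun _ => ?_⟩
      rw [Finsupp.single_eq_same]
      exact DGAlgebra.one_mem
    · rw [Finsupp.single_eq_of_ne hv]
      exact ⟨fun _ => rfl, fun _ => Submodule.zero_mem _⟩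
  -- `[r | w]` lies in `F n` as soon as all the words `[b | w]` that occur have weight `< n`
  have hconsW : ∀ (n : ℕ) (w : List β.Letter) (r : R),
      (∀ i : β.Letter, β.b.repr r i.1 ≠ 0 → β.weight (i :: w) < n) → β.consWord w r ∈ F n := by
    intro n w r h
    rw [← β.b.linearCombination_repr r, Finsupp.linearCombination_apply, map_finsuppSum]
    refine Submodule.sum_mem _ fun i _ => ?_
    dsimp only
    rw [map_smul]
    by_cases hi : β.deg i = 0
    · rw [β.consWord_b_zero w hi, smul_zero]
      exact Submodule.zero_mem _
    · by_cases hr : β.b.repr r i = 0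
      · rw [hr, zero_smul]
        exact Submodule.zero_mem _
      · rw [β.consWord_b w hi]
        exact Submodule.smul_mem _ _ (hone _ _ (h ⟨i, hi⟩ hr))
  suffices h : ∀ w, β.dWord w ∈ F (β.weight w) from h w v
  intro w
  induction w with
  | nil => exact Submodule.zero_mem _
  | cons i w ih =>
    have hc := hcons i w
    rw [dWord, map_add, contr_single]
    refine Submodule.sub_mem _ ?_ (Submodule.add_mem _ ?_ ?_)
    · intro v
      by_cases hv : v = w
      · subst hv
        constructor <;> intro h <;> exfalso <;> split_ifs at hc <;> omega
      · rw [Finsupp.single_eq_of_ne hv]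
        exact ⟨fun _ => rfl, fun _ => Submodule.zero_mem _⟩
    · refine hconsW _ _ _ fun j hj => ?_
      have hj0 := β.adapted _ _ hj
      have hi0 : DGAlgebra.d (k := k) (β.b i.1) ≠ 0 := by
        intro h0
        simp [h0] at hj
      rw [if_neg hi0] at hc
      rw [hc, hcons j w, if_pos hj0]
      omega
    · have : ∀ x : β.Bar, x ∈ F (β.weight w) →
          β.contr (β.b i.1 • x) ∈ F (β.weight (i :: w)) := by
        intro x hx
        conv in β.b i.1 • x => rw [← x.sum_single, Finsupp.sum, Finset.smul_sum]
        rw [map_sum]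
        refine Submodule.sum_mem _ fun v hv => ?_
        rw [Finsupp.smul_single, contr_single, smul_eq_mul]
        have hlt : β.weight v < β.weight w := by
          by_contra h
          exact (Finsupp.mem_support_iff.1 hv) ((hx v).1 (not_lt.1 h))
        refine hconsW _ _ _ fun j hj => ?_
        by_cases h2 : β.weight w < β.weight v + 2
        · have hx0 := (hx v).2 h2
          rw [← algebraMap_augmentation (k := k) hx0, ← Algebra.commutes, ← Algebra.smul_def,
            map_smul, Finsupp.smul_apply, β.b.repr_self] at hj
          have hji : i.1 = j.1 := by
            by_contra hne
            exact hj (by rw [Finsupp.single_eq_of_ne (Ne.symm hne), smul_zero])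
          have hij : i = j := Subtype.ext hji
          subst hij
          rw [hc, hcons]
          omega
        · have hcj := hcons j v
          split_ifs at hc hcj <;> omega
      have hsm := this _ ih
      rcases Int.units_eq_one_or (β.deg i.1).negOnePow with h | h <;> rw [h]
      · simpa using hsm
      · simpa using Submodule.neg_mem _ hsm

/-- The bar resolution is semi-free. -/
theorem bar_isSemiFree : IsSemiFree k R β.Bar := by
  refine ⟨List β.Letter, Finsupp.basisSingleOne, β.wordDeg, β.weight, fun w => ?_, fun w => ?_⟩
  · rw [Finsupp.coe_basisSingleOne]
    exact β.single_mem_barGr w DGAlgebra.one_mem (zero_add _)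
  · have : DGModule.d (k := k) R (Finsupp.basisSingleOne (R := R) w) = β.dWord w := by
      rw [Finsupp.coe_basisSingleOne]
      exact β.barD_single_one w
    rw [this, Module.Basis.mem_span_image]
    intro v hv
    by_contra h
    have h0 := (β.dWord_weight w v).1 (not_lt.1 h)
    simp only [Finset.mem_coe, Finsupp.mem_support_iff] at hv
    exact hv h0

/-- The bar resolution is a resolution of `k`. -/
theorem barAug_isQuasiIso : IsQuasiIso k R β.barAug where
  map_mem j x hx := by
    by_cases hj : j = 0
    · subst hj
      exact Submodule.mem_top
    · rw [barAug_apply]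
      have h1 := hx []
      rw [wordDeg_nil, sub_zero] at h1
      rw [augmentation_of_mem k R hj h1]
      exact Submodule.zero_mem _
  map_d x := by
    rw [barAug_apply]
    exact β.augmentation_barD x
  surj j y hy _ := by
    by_cases hj : j = 0
    · subst hj
      obtain ⟨c, rfl⟩ : ∃ c : k, Residue.of k R c = y := ⟨y, rfl⟩
      refine ⟨Finsupp.single [] (algebraMap k R c), ?_, ?_, 0, Submodule.zero_mem _, ?_⟩
      · refine β.single_mem_barGr [] (m := 0) ?_ rfl
        rw [hR.gr_zero]
        exact ⟨c, rfl⟩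
      · have := β.barD_single [] (algebraMap k R c)
        rw [d_algebraMap, Finsupp.single_zero, dWord, smul_zero, zero_add] at this
        exact this
      · have : β.barAug (Finsupp.single [] (algebraMap k R c)) = Residue.of k R c := by
          rw [barAug_apply, Finsupp.single_eq_same, AlgHom.commutes]
          rfl
        rw [this, sub_self, map_zero]
    · have hy0 : y = 0 := by
        have h : y ∈ (if j = 0 then ⊤ else ⊥ : Submodule k (Residue k R)) := hy
        rw [if_neg hj] at h
        exact (Submodule.mem_bot k).1 h
      exact ⟨0, Submodule.zero_mem _, map_zero _, 0, Submodule.zero_mem _, by simp [hy0]⟩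
  inj j x hx hdx h := by
    obtain ⟨z, -, hz⟩ := h
    have h0 : augmentation k R (x []) = 0 := by
      rw [barAug_apply] at hz
      exact hz
    have hc := β.barD_contr x
    have hdx' : β.barD x = 0 := hdx
    rw [hdx', map_zero, h0, map_zero, Finsupp.single_zero, sub_zero, add_zero] at hc
    exact ⟨β.contr x, β.contr_mem hx, hc.symm⟩

end AdaptedBasis

/-! ### Bass numbers -/

section Bass

variable (k : Type u) (R : Type v) (M : Type w) [Field k] [Ring R] [Algebra k R]
  [DGAlgebra k R] [SimplyConnectedCochain k R]
  [AddCommGroup M] [Module k M] [Module R M] [IsScalarTower k R M] [DGModule k R M]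

/-- The bar resolution of `k` over `R`: a semi-free DG left `R`-module with a quasi-isomorphism
to `k`, see `DG.AdaptedBasis.bar_isSemiFree` and `DG.AdaptedBasis.barAug_isQuasiIso`. -/
abbrev BarResolution : Type v := (exists_adaptedBasis k R).some.Bar

/-- `H^n(RHom_R(k, M))`, where `RHom_R(k, M) = Hom_R(P, M)` for the semi-free resolution `P` of
`k` given by the bar resolution. -/
abbrev RHomCohomology (n : ℤ) : Type (max v w) := HomCohomology k R (BarResolution k R) M n

/-- The Bass number `μ^n(M) = dim_k H^n(RHom_R(k, M))`. -/
noncomputable def bassNumber (n : ℤ) : Cardinal.{max v w} :=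
  Module.rank k (RHomCohomology k R M n)

/-- The Bass numbers of `M` have a gap of length `g`. -/
def HasBassGap (g : ℤ) : Prop :=
  ∃ j : ℤ, bassNumber k R M j ≠ 0 ∧
    (∀ l : ℤ, j + 1 ≤ l → l ≤ j + g → bassNumber k R M l = 0) ∧
    bassNumber k R M (j + g + 1) ≠ 0

end Bass

end DG

/-! Let `P` be the bar resolution of `k`. Since `R¹ = 0`, it is free on words of degree `≥ 0`, and
only the empty word `[]` has degree `0`. A gap between `j` and `j + g + 1` forces cohomology of `M`
at both ends of the gap, and this gives the bound on the amplitude.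

Upper end: the cohomology of `Hom_R(P, M)` in degree `n` only sees `H^i(M)` with `i ≥ n`
(`AdaptedBasis.homVanish_bar`), so `μ^(j+g+1) ≠ 0` yields some `i ≥ j + g + 1` with `H^i(M) ≠ 0`.

Lower end: `H^j(M) ≠ 0`, because `H^j(M) = 0` together with `μ^l = 0` for `j < l ≤ j + g` would
force `μ^j = 0` (`bassNumber_eq_zero_of_cycleVanish`). Indeed, `k` can be built from `R` by killing
the cohomology of `R` from the top degree down to degree `2`. If `L` has no cohomology above degree
`b`, a cycle of degree `b` is the value at `[]` of a cocycle `φ : P → L` of degree `b`, since the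
obstructions lie in degrees above `b + 1` (`AdaptedBasis.exists_homCocycle`). As `P` is a copy of
`k`, the cone of `φ` loses exactly this class, if it was nonzero (`Cone.exists_cycle`). The triangle
`L → Cone φ → P[1 - b]` shows that `H^j(Hom_R(-, M))` remains zero as long as `μ^(j+b-1) = 0`. Since
`2 ≤ b ≤ g`, only the Bass numbers in the gap are used. At the end `L` is a resolution of `k` and
`μ^j = 0` follows.

For `M = R` the amplitude is at most `sup R ≤ g`, so there is no gap. -/

set_option linter.unusedSectionVars false

namespace DG

/-! ### Vanishing and finiteness of cohomology in terms of cycles -/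

section Vanishing

variable {k : Type u} {V : Type v} [Field k] [AddCommGroup V] [Module k V]

theorem subsingleton_gradedCohomology_iff (gr : ℤ → Submodule k V) (d : ℤ → V →ₗ[k] V) (n : ℤ) :
    Subsingleton (GradedCohomology gr d n) ↔
      ∀ x ∈ gr n, d n x = 0 → ∃ y ∈ gr (n - 1), d (n - 1) y = x := by
  rw [Submodule.Quotient.subsingleton_iff, Submodule.submoduleOf, eq_top_iff]
  constructor
  · intro h x hx hdx
    have : (⟨x, hx, hdx⟩ : ↥(gr n ⊓ LinearMap.ker (d n))) ∈ (⊤ : Submodule k _) := trivial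
    obtain ⟨y, hy, hyx⟩ := h this
    exact ⟨y, hy, hyx⟩
  · rintro h ⟨x, hx, hdx⟩ -
    obtain ⟨y, hy, hyx⟩ := h x hx hdx
    exact ⟨y, hy, hyx⟩

/-- If the cohomology in degree `n` is finite dimensional, then it is spanned by the classes of
finitely many cycles. -/
theorem exists_spanning_cycles (gr : ℤ → Submodule k V) (d : ℤ → V →ₗ[k] V) (n : ℤ)
    (h : Module.Finite k (GradedCohomology gr d n)) :
    ∃ (m : ℕ) (s : Fin m → V), (∀ i, s i ∈ gr n ∧ d n (s i) = 0) ∧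
      ∀ x ∈ gr n, d n x = 0 → ∃ (c : Fin m → k), ∃ y ∈ gr (n - 1),
        x = ∑ i, c i • s i + d (n - 1) y := by
  obtain ⟨m, q, hq⟩ := Module.Finite.exists_fin (R := k) (M := GradedCohomology gr d n)
  choose t ht using fun i => Submodule.Quotient.mk_surjective _ (q i)
  refine ⟨m, fun i => (t i : V), fun i => (t i).2, fun x hx hdx => ?_⟩
  let x' : ↥(gr n ⊓ LinearMap.ker (d n)) := ⟨x, hx, hdx⟩
  have hmem : Submodule.Quotient.mk x' ∈ Submodule.span k (Set.range q) := by
    rw [hq]; trivial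
  rw [Submodule.mem_span_range_iff_exists_fun] at hmem
  obtain ⟨c, hc⟩ := hmem
  have h1 : Submodule.Quotient.mk (∑ i, c i • t i) = (Submodule.Quotient.mk x' :
      GradedCohomology gr d n) := by
    rw [← hc, ← Submodule.mkQ_apply, map_sum]
    exact Finset.sum_congr rfl fun i _ => by rw [map_smul, Submodule.mkQ_apply, ht]
  rw [eq_comm, Submodule.Quotient.eq] at h1
  obtain ⟨y, hy, hyx⟩ := h1
  refine ⟨c, y, hy, ?_⟩
  rw [hyx]
  simp [x']

end Vanishing

/-! ### Sign twists -/

section Twist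

variable (k : Type u) (R : Type v) [Field k] [Ring R] [Algebra k R] [DGAlgebra k R]

/-- The sign involution `a ↦ (-1)^|a| a` as an algebra homomorphism. -/
noncomputable def signHom : R →ₐ[k] R :=
  AlgHom.ofLinearMap (exists_adaptedBasis k R).some.sign
    (by
      rw [AdaptedBasis.sign_of_mem _ DGAlgebra.one_mem]
      simp)
    (by
      intro x y
      set β := (exists_adaptedBasis k R).some
      have : (LinearMap.mul k R).compr₂ β.sign = (LinearMap.mul k R).compl₁₂ β.sign β.sign := by
        refine β.b.ext fun i => LinearMap.ext fun y => ?_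
        simp only [LinearMap.compr₂_apply, LinearMap.mul_apply', LinearMap.compl₁₂_apply]
        rw [β.sign_mul (β.mem i), β.sign_b, smul_mul_assoc]
      exact LinearMap.congr_fun (LinearMap.congr_fun this x) y)

/-- The algebra homomorphism `a ↦ (-1)^(n |a|) a`. -/
noncomputable def twist (n : ℤ) : R →ₐ[k] R := if Even n then AlgHom.id k R else signHom k R

variable {R}

theorem twist_of_mem (n : ℤ) {i : ℤ} {a : R} (ha : a ∈ DGAlgebra.gr (k := k) i) :
    twist k R n a = (n * i).negOnePow • a := by
  unfold twist
  split_ifs with h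
  · rw [Int.negOnePow_even _ (h.mul_right i)]
    simp
  · have h1 : signHom k R a = i.negOnePow • a := AdaptedBasis.sign_of_mem _ ha
    rw [h1]
    congr 1
    rw [Int.negOnePow_eq_iff]
    obtain ⟨m, hm⟩ := Int.not_even_iff_odd.1 h
    exact ⟨-(m * i), by rw [hm]; ring⟩

theorem gr_induction {p : R → Prop} (h0 : p 0) (hadd : ∀ a b, p a → p b → p (a + b))
    (hmem : ∀ i, ∀ a ∈ DGAlgebra.gr (k := k) (R := R) i, p a) (a : R) : p a := by
  have ha : a ∈ ⨆ i, DGAlgebra.gr (k := k) (R := R) i := by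
    rw [(DGAlgebra.isInternal (k := k) (R := R)).submodule_iSup_eq_top]
    trivial
  exact Submodule.iSup_induction (DGAlgebra.gr (k := k) (R := R)) (motive := p) ha hmem h0 hadd

end Twist

/-! ### Hom complexes -/

section Hom

variable {k : Type u} {R : Type v} [Field k] [Ring R] [Algebra k R] [DGAlgebra k R]
  {P : Type*} [AddCommGroup P] [Module k P] [Module R P] [IsScalarTower k R P] [DGModule k R P]
  {Q : Type*} [AddCommGroup Q] [Module k Q] [Module R Q] [IsScalarTower k R Q] [DGModule k R Q]
  {M : Type*} [AddCommGroup M] [Module k M] [Module R M] [IsScalarTower k R M] [DGModule k R M]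

theorem map_negOnePow_smul {V W : Type*} [AddCommGroup V] [Module k V] [AddCommGroup W]
    [Module k W] (f : V →ₗ[k] W) (n : ℤ) (x : V) : f (n.negOnePow • x) = n.negOnePow • f x := by
  rcases Int.units_eq_one_or n.negOnePow with h | h <;> simp [h]

theorem smul_negOnePow_smul (a : R) (n : ℤ) (x : M) :
    a • n.negOnePow • x = n.negOnePow • a • x := by
  rcases Int.units_eq_one_or n.negOnePow with h | h <;> simp [h]

theorem negOnePow_smul_smul (a : R) (n : ℤ) (x : M) :
    (n.negOnePow • a) • x = n.negOnePow • a • x := by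
  rcases Int.units_eq_one_or n.negOnePow with h | h <;> simp [h]

theorem homD_apply (n : ℤ) (f : P →ₗ[k] M) (x : P) :
    homD k R P M n f x = DGModule.d (k := k) R (f x) -
      n.negOnePow • f (DGModule.d (k := k) R x) := rfl

/-- The sign rule in `homGr` concerns homogeneous scalars. Absorbing the sign in `twist` makes it
available for the coefficients of an element of a free module, which need not be homogeneous. -/
theorem map_smul_of_mem_homGr {n : ℤ} {f : P →ₗ[k] M} (hf : f ∈ homGr k R P M n) (a : R) (x : P) :
    f (a • x) = twist k R n a • f x := by
  refine gr_induction k (p := fun a => f (a • x) = twist k R n a • f x) (by simp)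
    (fun a b ha hb => ?_) (fun i a ha => ?_) a
  · rw [add_smul, map_add, ha, hb, map_add, add_smul]
  · rw [hf.2 i a ha, twist_of_mem k n ha, negOnePow_smul_smul]

theorem homD_mem {n : ℤ} {f : P →ₗ[k] M} (hf : f ∈ homGr k R P M n) :
    homD k R P M n f ∈ homGr k R P M (n + 1) := by
  refine ⟨fun j x hx => ?_, fun i a ha x => ?_⟩
  · rw [homD_apply]
    refine Submodule.sub_mem _ ?_ (AdaptedBasis.units_smul_mem _ _ ?_)
    · rw [← add_assoc]
      exact DGModule.d_mem (hf.1 j x hx)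
    · rw [add_comm n 1, ← add_assoc]
      exact hf.1 _ _ (DGModule.d_mem hx)
  · rw [homD_apply, homD_apply, hf.2 i a ha, DGModule.leibniz ha, map_negOnePow_smul,
      DGModule.leibniz ha, map_add, hf.2 _ _ (DGAlgebra.d_mem ha), map_negOnePow_smul, hf.2 i a ha,
      add_mul, Int.negOnePow_add, mul_add, Int.negOnePow_add, one_mul, mul_one]
    rcases Int.units_eq_one_or n.negOnePow with h | h <;>
    rcases Int.units_eq_one_or i.negOnePow with h' | h' <;>
    rcases Int.units_eq_one_or (n * i).negOnePow with h'' | h'' <;>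
    simp [h, h', h'', smul_sub] <;> abel

theorem homD_homD (n : ℤ) (f : P →ₗ[k] M) :
    homD k R P M (n + 1) (homD k R P M n f) = 0 := by
  ext x
  simp only [homD_apply, map_sub, map_negOnePow_smul, DGModule.d_d, Int.negOnePow_succ]
  rcases Int.units_eq_one_or n.negOnePow with h | h <;> simp [h]

theorem homD_homD' (n : ℤ) (f : P →ₗ[k] M) :
    homD k R P M n (homD k R P M (n - 1) f) = 0 := by
  have := homD_homD (R := R) (n - 1) f
  rwa [sub_add_cancel] at this

theorem homD_mem' {n : ℤ} {f : P →ₗ[k] M} (hf : f ∈ homGr k R P M (n - 1)) :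
    homD k R P M (n - 1) f ∈ homGr k R P M n := by
  have := homD_mem hf
  rwa [sub_add_cancel] at this

theorem comp_mem_homGr {ψ : P →ₗ[R] Q} (hψ : IsDGHom k R ψ) {n : ℤ} {f : Q →ₗ[k] M}
    (hf : f ∈ homGr k R Q M n) : f ∘ₗ ψ.restrictScalars k ∈ homGr k R P M n :=
  ⟨fun j x hx => hf.1 j _ (hψ.map_mem j x hx), fun i a ha x => by
    simp [hf.2 i a ha]⟩

theorem homD_comp {ψ : P →ₗ[R] Q} (hψ : IsDGHom k R ψ) (n : ℤ) (f : Q →ₗ[k] M) :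
    homD k R P M n (f ∘ₗ ψ.restrictScalars k) = homD k R Q M n f ∘ₗ ψ.restrictScalars k := by
  ext x
  simp [homD_apply, hψ.map_d]

variable (k R P M) in
/-- Every cocycle of degree `n` of the complex `Hom_R(P, M)` is a coboundary. -/
def HomVanish (n : ℤ) : Prop :=
  ∀ f ∈ homGr k R P M n, homD k R P M n f = 0 →
    ∃ h ∈ homGr k R P M (n - 1), homD k R P M (n - 1) h = f

variable (k R M) in
/-- Every cycle of degree `n` of `M` is a boundary. -/
def CycleVanish (n : ℤ) : Prop :=
  ∀ x ∈ DGModule.gr (k := k) R (M := M) n, DGModule.d (k := k) R x = 0 →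
    ∃ y ∈ DGModule.gr (k := k) R (n - 1), DGModule.d (k := k) R y = x

theorem subsingleton_cohomology_iff (n : ℤ) :
    Subsingleton (Cohomology k R M n) ↔ CycleVanish k R M n :=
  subsingleton_gradedCohomology_iff _ _ _

theorem subsingleton_homCohomology_iff (n : ℤ) :
    Subsingleton (HomCohomology k R P M n) ↔ HomVanish k R P M n :=
  subsingleton_gradedCohomology_iff _ _ _

/-- If the identity of `P` is null-homotopic, then `Hom_R(P, M)` is acyclic. -/
theorem homVanish_of_homVanish_self (h : HomVanish k R P P 0) (n : ℤ) : HomVanish k R P M n := by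
  intro f hf hdf
  -- The identity is a cocycle of degree `0`; the resulting `s` has degree `-1` and satisfies `d s +
  -- s d = id`.
  obtain ⟨s, hs, hds⟩ := h LinearMap.id ⟨fun j x hx => by simpa using hx, fun i a ha x => by simp⟩
    (by ext x; simp [homD_apply])
  -- Since `f` is a cocycle of degree `n`, the differential of `f ∘ s` is `(-1)^n f (d s + s d) =
  -- (-1)^n f`, whence the sign of the witness.
  refine ⟨n.negOnePow • (f ∘ₗ s), AdaptedBasis.units_smul_mem _ _ ⟨fun j x hx => ?_,
    fun i a ha x => ?_⟩, ?_⟩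
  · have := hf.1 _ _ (hs.1 j x hx)
    rwa [show j + (0 - 1) + n = j + (n - 1) by ring] at this
  · simp only [LinearMap.comp_apply]
    rw [hs.2 i a ha, map_negOnePow_smul, hf.2 i a ha, smul_smul, ← Int.negOnePow_add]
    congr 2
    ring
  · ext x
    have h1 := LinearMap.congr_fun hds x
    have h2 := LinearMap.congr_fun hdf (s x)
    rw [homD_apply, LinearMap.zero_apply, sub_eq_zero] at h2
    rw [homD_apply, LinearMap.id_apply] at h1
    conv_rhs => rw [← h1, map_sub, map_negOnePow_smul]
    rw [homD_apply, LinearMap.smul_apply, LinearMap.smul_apply, LinearMap.comp_apply,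
      LinearMap.comp_apply, map_negOnePow_smul, h2, Int.negOnePow_sub, Int.negOnePow_one,
      show (0 - 1 : ℤ).negOnePow = -1 by simp]
    rcases Int.units_eq_one_or n.negOnePow with h | h <;> simp [h]

end Hom

/-! ### Shifts of DG modules -/

section Shift

/-- The module `Q`, with the grading shifted by `c` and with signs: `Shift k c Q` is `Q[c]`. -/
@[nolint unusedArguments]
def Shift (k : Type u) (_c : ℤ) (Q : Type w) [Field k] : Type w := Q

variable {k : Type u} {R : Type v} [Field k] [Ring R] [Algebra k R] [DGAlgebra k R]
  {c : ℤ}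
  {Q : Type*} [AddCommGroup Q] [Module k Q] [Module R Q] [IsScalarTower k R Q] [DGModule k R Q]
  {M : Type*} [AddCommGroup M] [Module k M] [Module R M] [IsScalarTower k R M] [DGModule k R M]

instance : AddCommGroup (Shift k c Q) := inferInstanceAs (AddCommGroup Q)

instance : Module k (Shift k c Q) := inferInstanceAs (Module k Q)

noncomputable instance : Module R (Shift k c Q) := Module.compHom Q (twist k R c).toRingHom

variable (k c Q) in
/-- The identity map from `Q` to its shift. -/
def toShift : Q ≃ₗ[k] Shift k c Q := LinearEquiv.refl k Q

theorem smul_toShift (a : R) (x : Q) : a • toShift k c Q x = toShift k c Q (twist k R c a • x) :=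
  rfl

theorem smul_toShift_of_mem {i : ℤ} {a : R} (ha : a ∈ DGAlgebra.gr (k := k) i) (x : Q) :
    a • toShift k c Q x = (c * i).negOnePow • toShift k c Q (a • x) := by
  rw [smul_toShift, twist_of_mem k c ha, negOnePow_smul_smul]
  exact map_negOnePow_smul (toShift k c Q).toLinearMap _ _

theorem toShift_smul_of_mem {i : ℤ} {a : R} (ha : a ∈ DGAlgebra.gr (k := k) i) (x : Q) :
    toShift k c Q (a • x) = (c * i).negOnePow • (a • toShift k c Q x) := by
  rw [smul_toShift_of_mem ha, smul_smul, Int.units_mul_self, one_smul]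

instance : IsScalarTower k R (Shift k c Q) :=
  ⟨fun a r x => by
    obtain ⟨x, rfl⟩ := (toShift k c Q).surjective x
    rw [smul_toShift, smul_toShift, map_smul (twist k R c), smul_assoc]
    rfl⟩

theorem isInternal_shift {V : Type*} [AddCommGroup V] [Module k V] {gr : ℤ → Submodule k V}
    (h : DirectSum.IsInternal gr) (c : ℤ) : DirectSum.IsInternal fun n => gr (n + c) := by
  rw [DirectSum.isInternal_submodule_iff_iSupIndep_and_iSup_eq_top] at h ⊢
  exact ⟨h.1.comp (add_left_injective c), by rw [← h.2]; exact (Equiv.addRight c).iSup_comp⟩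

noncomputable instance : DGModule k R (Shift k c Q) where
  gr n := (DGModule.gr (k := k) R (M := Q) (n + c) : Submodule k Q)
  isInternal := isInternal_shift (V := Q) (DGModule.isInternal (k := k) (R := R) (M := Q)) c
  smul_mem := by
    intro i j a x ha hx
    obtain ⟨x, rfl⟩ := (toShift k c Q).surjective x
    rw [smul_toShift_of_mem ha]
    refine AdaptedBasis.units_smul_mem _ _ ?_
    rw [add_assoc]
    have h : a • x ∈ DGModule.gr (k := k) R (M := Q) (i + (j + c)) := DGModule.smul_mem ha hx
    exact h
  d := (toShift k c Q).toLinearMap ∘ₗ (c.negOnePow • DGModule.d (k := k) R (M := Q)) ∘ₗ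
    (toShift k c Q).symm.toLinearMap
  d_mem := by
    intro i x hx
    have h : DGModule.d (k := k) R ((toShift k c Q).symm x) ∈
        DGModule.gr (k := k) R (M := Q) (i + c + 1) := DGModule.d_mem hx
    rw [add_right_comm]
    exact AdaptedBasis.units_smul_mem _ _ h
  d_d x := by
    obtain ⟨x, rfl⟩ := (toShift k c Q).surjective x
    simp only [LinearMap.comp_apply, LinearMap.smul_apply, LinearEquiv.coe_coe,
      LinearEquiv.symm_apply_apply]
    rw [map_negOnePow_smul (DGModule.d (k := k) R), DGModule.d_d, smul_zero, smul_zero, map_zero]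
  leibniz := by
    intro i a ha x
    obtain ⟨x, rfl⟩ := (toShift k c Q).surjective x
    have hs : ∀ (n : ℤ) (y : Q), toShift k c Q (n.negOnePow • y) =
      n.negOnePow • toShift k c Q y := map_negOnePow_smul (toShift k c Q).toLinearMap
    have hs' : ∀ (n : ℤ) (y : Shift k c Q), (toShift k c Q).symm (n.negOnePow • y) =
      n.negOnePow • (toShift k c Q).symm y :=
      map_negOnePow_smul (toShift k c Q).symm.toLinearMap
    simp only [LinearMap.comp_apply, LinearMap.smul_apply, LinearEquiv.coe_coe,
      LinearEquiv.symm_apply_apply]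
    rw [smul_toShift_of_mem ha, smul_toShift_of_mem (DGAlgebra.d_mem ha), hs', hs,
      map_negOnePow_smul (DGModule.d (k := k) R), LinearEquiv.symm_apply_apply,
      DGModule.leibniz ha, hs c, smul_negOnePow_smul, smul_toShift_of_mem ha, mul_add,
      Int.negOnePow_add, hs (c * i), map_add, hs i, mul_one]
    rcases Int.units_eq_one_or c.negOnePow with h | h <;>
    rcases Int.units_eq_one_or i.negOnePow with h' | h' <;>
    rcases Int.units_eq_one_or (c * i).negOnePow with h'' | h'' <;>
    simp [h, h', h'']

theorem toShift_mem {n : ℤ} {x : Q} : toShift k c Q x ∈ DGModule.gr (k := k) R n ↔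
    x ∈ DGModule.gr (k := k) R (n + c) := Iff.rfl

theorem d_toShift (x : Q) : DGModule.d (k := k) R (toShift k c Q x) =
    c.negOnePow • toShift k c Q (DGModule.d (k := k) R x) := rfl

theorem comp_toShift_mem_homGr {n : ℤ} {f : Shift k c Q →ₗ[k] M} :
    f ∘ₗ (toShift k c Q).toLinearMap ∈ homGr k R Q M (n - c) ↔
      f ∈ homGr k R (Shift k c Q) M n := by
  constructor
  · rintro ⟨h1, h2⟩
    refine ⟨fun j x hx => ?_, fun i a ha x => ?_⟩ <;>
      obtain ⟨x, rfl⟩ := (toShift k c Q).surjective x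
    · have := h1 _ x (toShift_mem.1 hx)
      rwa [show j + c + (n - c) = j + n by ring] at this
    · have := h2 i a ha x
      simp only [LinearMap.comp_apply, LinearEquiv.coe_coe] at this
      rw [smul_toShift_of_mem ha, map_negOnePow_smul, this, smul_smul, ← Int.negOnePow_add]
      congr 2
      ring
  · rintro ⟨h1, h2⟩
    refine ⟨fun j x hx => ?_, fun i a ha x => ?_⟩
    · have := h1 (j - c) (toShift k c Q x) (toShift_mem.2 (by rwa [sub_add_cancel]))
      rwa [show j - c + n = j + (n - c) by ring] at this
    · have := h2 i a ha (toShift k c Q x)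
      simp only [LinearMap.comp_apply, LinearEquiv.coe_coe]
      rw [toShift_smul_of_mem ha, map_negOnePow_smul, this, smul_smul, ← Int.negOnePow_add]
      congr 1
      rw [Int.negOnePow_eq_iff]
      exact ⟨c * i, by ring⟩

/-- The factor `(-1)^c` in the differential of the shift accounts exactly for the passage from
`(-1)^n` to `(-1)^(n - c)`, so no sign is needed in the identification of the two Hom complexes. -/
theorem homD_comp_toShift (n : ℤ) (f : Shift k c Q →ₗ[k] M) :
    homD k R Q M (n - c) (f ∘ₗ (toShift k c Q).toLinearMap) =
      homD k R (Shift k c Q) M n f ∘ₗ (toShift k c Q).toLinearMap := by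
  ext x
  simp only [homD_apply, LinearMap.comp_apply, LinearEquiv.coe_coe, d_toShift]
  rw [map_negOnePow_smul, smul_smul, ← Int.negOnePow_add, Int.negOnePow_sub, Int.negOnePow_add]

theorem homVanish_shift_iff (n : ℤ) :
    HomVanish k R (Shift k c Q) M n ↔ HomVanish k R Q M (n - c) := by
  have hcomp : ∀ h : Q →ₗ[k] M, (h ∘ₗ (toShift k c Q).symm.toLinearMap) ∘ₗ
      (toShift k c Q).toLinearMap = h := fun h => LinearMap.ext fun x => by simp
  have hinj : ∀ {f g : Shift k c Q →ₗ[k] M}, f ∘ₗ (toShift k c Q).toLinearMap =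
      g ∘ₗ (toShift k c Q).toLinearMap → f = g := by
    intro f g h
    ext x
    obtain ⟨x, rfl⟩ := (toShift k c Q).surjective x
    exact LinearMap.congr_fun h x
  constructor
  · intro H f hf hdf
    have h1 : f ∘ₗ (toShift k c Q).symm.toLinearMap ∈ homGr k R (Shift k c Q) M n := by
      rw [← comp_toShift_mem_homGr, hcomp]
      exact hf
    obtain ⟨h, hh, hdh⟩ := H _ h1 (hinj (by rw [← homD_comp_toShift, hcomp, hdf]; rfl))
    refine ⟨h ∘ₗ (toShift k c Q).toLinearMap, ?_, ?_⟩
    · rw [sub_right_comm, comp_toShift_mem_homGr]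
      exact hh
    · rw [sub_right_comm, homD_comp_toShift, hdh, hcomp]
  · intro H f hf hdf
    obtain ⟨h, hh, hdh⟩ := H _ (comp_toShift_mem_homGr.2 hf)
      (by rw [homD_comp_toShift, hdf]; rfl)
    rw [sub_right_comm] at hh hdh
    refine ⟨h ∘ₗ (toShift k c Q).symm.toLinearMap, ?_, hinj ?_⟩
    · rw [← comp_toShift_mem_homGr, hcomp]
      exact hh
    · rw [← homD_comp_toShift, hcomp, hdh]

end Shift

/-! ### Mapping cones and the exact sequences they induce -/

section Cone

variable (k : Type u) (R : Type v) [Field k] [Ring R] [Algebra k R] [DGAlgebra k R]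
  (Q : Type*) [AddCommGroup Q] [Module k Q] [Module R Q] [IsScalarTower k R Q] [DGModule k R Q]
  (L : Type*) [AddCommGroup L] [Module k L] [Module R L] [IsScalarTower k R L] [DGModule k R L]

/-- The cocycles of degree `b` of the complex `Hom_R(Q, L)`. -/
def HomCocycle (b : ℤ) : Type _ :=
  {φ : Q →ₗ[k] L // φ ∈ homGr k R Q L b ∧ homD k R Q L b φ = 0}

variable {k R Q L} {b : ℤ}

theorem HomCocycle.d_apply (φ : HomCocycle k R Q L b) (x : Q) :
    DGModule.d (k := k) R (φ.1 x) = b.negOnePow • φ.1 (DGModule.d (k := k) R x) :=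
  sub_eq_zero.1 (LinearMap.congr_fun φ.2.2 x)

/-- The mapping cone of a cocycle of degree `b` of `Hom_R(Q, L)`. -/
def Cone (_φ : HomCocycle k R Q L b) : Type _ := L × Shift k (1 - b) Q

variable (φ : HomCocycle k R Q L b)

instance : AddCommGroup (Cone φ) := inferInstanceAs (AddCommGroup (L × Shift k (1 - b) Q))

instance : Module k (Cone φ) := inferInstanceAs (Module k (L × Shift k (1 - b) Q))

noncomputable instance : Module R (Cone φ) :=
  inferInstanceAs (Module R (L × Shift k (1 - b) Q))

instance : IsScalarTower k R (Cone φ) :=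
  inferInstanceAs (IsScalarTower k R (L × Shift k (1 - b) Q))

/-- The element of the cone with the given components. -/
def Cone.mk (x : L) (y : Q) : Cone φ := (x, toShift k (1 - b) Q y)

variable {φ} in
theorem Cone.cases {p : Cone φ → Prop} (h : ∀ x y, p (Cone.mk φ x y)) (z : Cone φ) : p z :=
  h z.1 ((toShift k (1 - b) Q).symm z.2)

theorem isInternal_prod {V W : Type*} [AddCommGroup V] [Module k V] [AddCommGroup W] [Module k W]
    {gr : ℤ → Submodule k V} {gr' : ℤ → Submodule k W} (h : DirectSum.IsInternal gr)
    (h' : DirectSum.IsInternal gr') : DirectSum.IsInternal fun n => (gr n).prod (gr' n) := by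
  rw [DirectSum.isInternal_submodule_iff_iSupIndep_and_iSup_eq_top] at h h' ⊢
  constructor
  · have h1 := h.1
    have h2 := h'.1
    rw [iSupIndep_iff_finsetSum_eq_zero_imp_eq_zero] at h1 h2 ⊢
    intro s x hx hsum n hn
    have e1 := h1 s (fun m => (x m).1) (fun m hm => (hx m hm).1)
      (by rw [← Prod.fst_sum, hsum]; rfl) n hn
    have e2 := h2 s (fun m => (x m).2) (fun m hm => (hx m hm).2)
      (by rw [← Prod.snd_sum, hsum]; rfl) n hn
    exact Prod.ext e1 e2
  · rw [eq_top_iff]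
    rintro ⟨x, y⟩ -
    have hx : x ∈ ⨆ n, gr n := by rw [h.2]; trivial
    have hy : y ∈ ⨆ n, gr' n := by rw [h'.2]; trivial
    have ex : (x, (0 : W)) ∈ ⨆ n, (gr n).prod (gr' n) := by
      have := Submodule.mem_map_of_mem (f := LinearMap.inl k V W) hx
      rw [Submodule.map_iSup] at this
      refine (iSup_mono fun n => ?_ : _ ≤ ⨆ n, (gr n).prod (gr' n)) this
      rintro _ ⟨z, hz, rfl⟩
      exact ⟨hz, Submodule.zero_mem _⟩
    have ey : ((0 : V), y) ∈ ⨆ n, (gr n).prod (gr' n) := by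
      have := Submodule.mem_map_of_mem (f := LinearMap.inr k V W) hy
      rw [Submodule.map_iSup] at this
      refine (iSup_mono fun n => ?_ : _ ≤ ⨆ n, (gr n).prod (gr' n)) this
      rintro _ ⟨z, hz, rfl⟩
      exact ⟨Submodule.zero_mem _, hz⟩
    simpa using Submodule.add_mem _ ex ey

/-- The differential of the mapping cone. -/
noncomputable def coneD : L × Shift k (1 - b) Q →ₗ[k] L × Shift k (1 - b) Q :=
  (DGModule.d (k := k) R ∘ₗ LinearMap.fst k L (Shift k (1 - b) Q) +
    φ.1 ∘ₗ (toShift k (1 - b) Q).symm.toLinearMap ∘ₗ LinearMap.snd k L (Shift k (1 - b) Q)).prod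
  (DGModule.d (k := k) R ∘ₗ LinearMap.snd k L (Shift k (1 - b) Q))

theorem coneD_apply (x : L) (y : Q) : coneD φ (x, toShift k (1 - b) Q y) =
    (DGModule.d (k := k) R x + φ.1 y,
      (1 - b).negOnePow • toShift k (1 - b) Q (DGModule.d (k := k) R y)) := rfl

/-- The shift `1 - b` is chosen so that `φ`, of degree `b` on `Q`, has degree `1` on the shift. Its
differential carries `(-1)^(1 - b)`, which is opposite to the sign `(-1)^b` by which `φ` commutes
with `d`, so the two mixed terms cancel. -/
theorem coneD_coneD (z : L × Shift k (1 - b) Q) : coneD φ (coneD φ z) = 0 := by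
  obtain ⟨x, y⟩ := z
  obtain ⟨y, rfl⟩ := (toShift k (1 - b) Q).surjective y
  rw [coneD_apply]
  refine Prod.ext ?_ (DGModule.d_d (R := R) (k := k) (toShift k (1 - b) Q y))
  change DGModule.d (k := k) R (DGModule.d (k := k) R x + φ.1 y) +
    φ.1 ((1 - b).negOnePow • DGModule.d (k := k) R y) = 0
  rw [map_add, DGModule.d_d, φ.d_apply, map_negOnePow_smul, zero_add, Int.negOnePow_sub]
  simp

noncomputable instance : DGModule k R (Cone φ) where
  gr n := (DGModule.gr (k := k) R n).prod (DGModule.gr (k := k) R n)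
  isInternal := isInternal_prod (V := L) (W := Shift k (1 - b) Q)
    (DGModule.isInternal (k := k) (R := R)) (DGModule.isInternal (k := k) (R := R))
  smul_mem ha hx := ⟨DGModule.smul_mem ha hx.1, DGModule.smul_mem ha hx.2⟩
  d := coneD φ
  d_mem := by
    intro i x hx
    refine ⟨Submodule.add_mem _ (DGModule.d_mem hx.1) ?_, DGModule.d_mem hx.2⟩
    have := φ.2.1.1 _ _ (toShift_mem.1 hx.2)
    rwa [show i + (1 - b) + b = i + 1 by ring] at this
  d_d := coneD_coneD φ
  leibniz := by
    intro i a ha x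
    obtain ⟨x, y⟩ := x
    refine Prod.ext ?_ (DGModule.leibniz ha y)
    obtain ⟨y, rfl⟩ := (toShift k (1 - b) Q).surjective y
    change DGModule.d (k := k) R (a • x) + φ.1 (twist k R (1 - b) a • y) =
      DGAlgebra.d (k := k) a • x + i.negOnePow • (a • (DGModule.d (k := k) R x + φ.1 y))
    rw [DGModule.leibniz ha, twist_of_mem k _ ha, negOnePow_smul_smul,
      map_negOnePow_smul, φ.2.1.2 i a ha, smul_add, smul_add, add_assoc, smul_smul,
      ← Int.negOnePow_add, show (1 - b) * i + b * i = i by ring]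

theorem Cone.mk_mem {n : ℤ} {x : L} {y : Q} : Cone.mk φ x y ∈ DGModule.gr (k := k) R n ↔
    x ∈ DGModule.gr (k := k) R n ∧ y ∈ DGModule.gr (k := k) R (n + (1 - b)) := Iff.rfl

theorem Cone.d_mk (x : L) (y : Q) : DGModule.d (k := k) R (Cone.mk φ x y) =
    Cone.mk φ (DGModule.d (k := k) R x + φ.1 y) ((1 - b).negOnePow • DGModule.d (k := k) R y) :=
  rfl

/-- The inclusion of `L` into the cone. -/
noncomputable def Cone.inl : L →ₗ[R] Cone φ := LinearMap.inl R L (Shift k (1 - b) Q)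

/-- The projection of the cone to the shift of `Q`. -/
noncomputable def Cone.snd : Cone φ →ₗ[R] Shift k (1 - b) Q :=
  LinearMap.snd R L (Shift k (1 - b) Q)

theorem Cone.inl_isDGHom : IsDGHom k R (Cone.inl φ) where
  map_mem _ _ hx := ⟨hx, Submodule.zero_mem _⟩
  map_d _ := by
    refine Prod.ext ?_ (map_zero (DGModule.d (k := k) R (M := Shift k (1 - b) Q))).symm
    exact ((congrArg _ (map_zero φ.1)).trans (add_zero _)).symm

theorem Cone.snd_isDGHom : IsDGHom k R (Cone.snd φ) where
  map_mem _ _ hx := hx.2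
  map_d _ := rfl

variable {M : Type*} [AddCommGroup M] [Module k M] [Module R M] [IsScalarTower k R M]
  [DGModule k R M]

/-- A map on `L` extends by zero to the cone. -/
theorem Cone.comp_fst_mem_homGr {n : ℤ} {h : L →ₗ[k] M} (hh : h ∈ homGr k R L M n) :
    (show Cone φ →ₗ[k] M from h ∘ₗ LinearMap.fst k L (Shift k (1 - b) Q)) ∈
      homGr k R (Cone φ) M n :=
  ⟨fun j _ hx => hh.1 j _ hx.1, fun i a ha x => hh.2 i a ha x.1⟩

/-- A cochain on the cone whose restriction to `L` is a coboundary can be modified by a coboundary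
so that it factors over the shift of `Q`. -/
theorem Cone.exists_sub_eq_comp_snd {n : ℤ} {f : Cone φ →ₗ[k] M} (hf : f ∈ homGr k R (Cone φ) M n)
    {h : L →ₗ[k] M} (hh : h ∈ homGr k R L M (n - 1))
    (hfh : homD k R L M (n - 1) h = f ∘ₗ (Cone.inl φ).restrictScalars k) :
    ∃ h' ∈ homGr k R (Cone φ) M (n - 1), ∃ g ∈ homGr k R (Shift k (1 - b) Q) M n,
      f - homD k R (Cone φ) M (n - 1) h' = g ∘ₗ (Cone.snd φ).restrictScalars k := by
  -- As a graded module the cone is `L ⊕ Q[1 - b]`, so `h` extends by zero. Subtracting the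
  -- coboundary of the extension makes `f` vanish on `L`.
  let h' : Cone φ →ₗ[k] M := h ∘ₗ LinearMap.fst k L (Shift k (1 - b) Q)
  have hh' := Cone.comp_fst_mem_homGr φ hh
  let f' := f - homD k R (Cone φ) M (n - 1) h'
  have hf' : f' ∈ homGr k R (Cone φ) M n := Submodule.sub_mem _ hf (homD_mem' hh')
  have h0 : f' ∘ₗ (Cone.inl φ).restrictScalars k = 0 := by
    rw [LinearMap.sub_comp, ← homD_comp (Cone.inl_isDGHom φ), ← hfh]
    exact sub_self _
  refine ⟨h', hh', f' ∘ₗ LinearMap.inr k L (Shift k (1 - b) Q), ⟨fun j x hx => ?_,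
    fun i a ha x => ?_⟩, ?_⟩
  · exact hf'.1 j (0, x) ⟨Submodule.zero_mem _, hx⟩
  · have : f' (a • ((0, x) : L × Shift k (1 - b) Q)) = _ := hf'.2 i a ha (0, x)
    rwa [Prod.smul_mk, smul_zero] at this
  · refine LinearMap.ext fun z => ?_
    have h1 : z = Cone.inl φ z.1 + (show Cone φ from (0, z.2)) := by
      refine Prod.ext ?_ ?_
      · exact (add_zero z.1).symm
      · exact (zero_add z.2).symm
    have h2 := LinearMap.congr_fun h0 z.1
    change f' z = f' (0, z.2)
    conv_lhs => rw [h1]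
    rw [map_add]
    exact (congrArg (· + f' (0, z.2)) h2).trans (zero_add _)

theorem Cone.eq_of_comp_snd_eq {f g : Shift k (1 - b) Q →ₗ[k] M}
    (h : f ∘ₗ (Cone.snd φ).restrictScalars k = g ∘ₗ (Cone.snd φ).restrictScalars k) : f = g :=
  LinearMap.ext fun x => LinearMap.congr_fun h (0, x)

/-- Exactness of `Hom_R(-, M)` at the middle term of `L → Cone φ → Q[1 - b]`. -/
theorem Cone.homVanish {n : ℤ} (hL : HomVanish k R L M n)
    (hQ : HomVanish k R Q M (n - (1 - b))) : HomVanish k R (Cone φ) M n := by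
  intro f hf hdf
  obtain ⟨h, hh, hdh⟩ := hL _ (comp_mem_homGr (Cone.inl_isDGHom φ) hf)
    (by rw [homD_comp (Cone.inl_isDGHom φ), hdf]; rfl)
  obtain ⟨h', hh', g, hg, hfg⟩ := Cone.exists_sub_eq_comp_snd φ hf hh hdh
  -- The cochain `g` is a cocycle because its pullback to the cone is one and the projection is
  -- surjective.
  obtain ⟨s, hs, hds⟩ := (homVanish_shift_iff n).2 hQ g hg <| Cone.eq_of_comp_snd_eq φ <| by
    rw [← homD_comp (Cone.snd_isDGHom φ), ← hfg, map_sub, hdf, homD_homD', sub_zero]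
    rfl
  refine ⟨s ∘ₗ (Cone.snd φ).restrictScalars k + h',
    Submodule.add_mem _ (comp_mem_homGr (Cone.snd_isDGHom φ) hs) hh', ?_⟩
  rw [map_add, homD_comp (Cone.snd_isDGHom φ), hds, ← hfg, sub_add_cancel]

/-- Exactness of `Hom_R(-, M)` at the last term of `L → Cone φ → Q[1 - b] → L[1]`. -/
theorem Cone.homVanish_right {n : ℤ} (hL : HomVanish k R L M (n - 1))
    (hC : HomVanish k R (Cone φ) M n) : HomVanish k R Q M (n - (1 - b)) := by
  rw [← homVanish_shift_iff]
  intro f hf hdf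
  obtain ⟨K, hK, hdK⟩ := hC _ (comp_mem_homGr (Cone.snd_isDGHom φ) hf)
    (by rw [homD_comp (Cone.snd_isDGHom φ), hdf]; rfl)
  -- The coboundary of `K` is pulled back from the shift of `Q` and hence is zero on `L`, so `K`
  -- restricts to a cocycle on `L`. Once `K` is corrected by a coboundary, it too is pulled back
  -- from the shift.
  obtain ⟨h, hh, hdh⟩ := hL _ (comp_mem_homGr (Cone.inl_isDGHom φ) hK) (by
    rw [homD_comp (Cone.inl_isDGHom φ), hdK]
    exact LinearMap.ext fun x => map_zero f)
  obtain ⟨h', hh', g, hg, hfg⟩ := Cone.exists_sub_eq_comp_snd φ hK hh hdh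
  refine ⟨g, hg, Cone.eq_of_comp_snd_eq φ ?_⟩
  rw [← homD_comp (Cone.snd_isDGHom φ), ← hfg, map_sub, homD_homD', sub_zero, hdK]

end Cone

/-- Choices by recursion along a weight function: if the condition `p y a z` on the value `z` at
`a` only depends on the values of `y` at elements of smaller weight, then there is a function `y`
that satisfies it wherever possible, and vanishes elsewhere. -/
theorem exists_recursive_choice {α N : Type*} [Zero N] (wt : α → ℕ)
    (p : (α → N) → α → N → Prop)
    (hp : ∀ y y' a, (∀ b, wt b < wt a → y b = y' b) → ∀ z, p y a z → p y' a z) :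
    ∃ y : α → N, ∀ a, ((∃ z, p y a z) → p y a (y a)) ∧ ((¬ ∃ z, p y a z) → y a = 0) := by
  classical
  -- The condition at `a` is tested on the values chosen so far, extended by zero. By `hp` the
  -- extension does not matter.
  let ext : ∀ a, (∀ b, wt b < wt a → N) → α → N := fun a r b =>
    if h : wt b < wt a then r b h else 0
  let F : ∀ a, (∀ b, wt b < wt a → N) → N := fun a r =>
    if h : ∃ z, p (ext a r) a z then h.choose else 0
  let wf : WellFounded fun a b => wt a < wt b := (measure wt).wf
  let y : α → N := wf.fix F
  have hy : ∀ a, y a = F a fun b _ => y b := fun a => wf.fix_eq F a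
  have hext : ∀ a b, wt b < wt a → ext a (fun b _ => y b) b = y b := fun a b h => dif_pos h
  refine ⟨y, fun a => ⟨fun ⟨z, hz⟩ => ?_, fun h => ?_⟩⟩
  · have hex : ∃ z, p (ext a fun b _ => y b) a z :=
      ⟨z, hp _ _ a (fun b hb => (hext a b hb).symm) z hz⟩
    have : y a = hex.choose := (hy a).trans (dif_pos hex)
    rw [this]
    exact hp _ _ a (hext a) _ hex.choose_spec
  · rw [hy]
    exact dif_neg fun ⟨z, hz⟩ => h ⟨z, hp _ _ a (hext a) z hz⟩

/-! ### Obstruction theory on the bar resolution -/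

namespace AdaptedBasis

variable {k : Type u} {R : Type v} [Field k] [Ring R] [Algebra k R] [DGAlgebra k R]
  (β : AdaptedBasis k R)
  {N : Type*} [AddCommGroup N] [Module k N] [Module R N] [IsScalarTower k R N] [DGModule k R N]

/-- The `k`-linear map `r [w] ↦ (-1)^(m |r|) r y_w`. -/
noncomputable def barLift (m : ℤ) (y : List β.Letter → N) : β.Bar →ₗ[k] N :=
  Finsupp.lsum k fun w => (LinearMap.toSpanSingleton R N (y w)).restrictScalars k ∘ₗ
    (twist k R m).toLinearMap

theorem barLift_single (m : ℤ) (y : List β.Letter → N) (w : List β.Letter) (r : R) :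
    β.barLift m y (Finsupp.single w r) = twist k R m r • y w := by
  rw [barLift, Finsupp.lsum_single]
  rfl

theorem barLift_smul (m : ℤ) (y : List β.Letter → N) (a : R) (x : β.Bar) :
    β.barLift m y (a • x) = twist k R m a • β.barLift m y x := by
  induction x using Finsupp.induction_linear with
  | zero => simp
  | add x x' h h' => rw [smul_add, map_add, h, h', map_add, smul_add]
  | single w r => rw [Finsupp.smul_single, barLift_single, barLift_single, smul_eq_mul, map_mul,
      mul_smul]

theorem barLift_congr (m : ℤ) {y y' : List β.Letter → N} (x : β.Bar)
    (h : ∀ w, x w ≠ 0 → y w = y' w) : β.barLift m y x = β.barLift m y' x := by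
  conv => congr <;> rw [← x.sum_single]
  rw [map_finsuppSum, map_finsuppSum]
  refine Finset.sum_congr rfl fun w hw => ?_
  dsimp only
  rw [barLift_single, barLift_single, h w (Finsupp.mem_support_iff.1 hw)]

variable [hR : SimplyConnectedCochain k R]

theorem barLift_mem {m : ℤ} {y : List β.Letter → N}
    (hy : ∀ w, y w ∈ DGModule.gr (k := k) R (m + β.wordDeg w)) :
    β.barLift m y ∈ homGr k R β.Bar N m := by
  refine ⟨fun j x hx => β.map_barGr _ _ j (fun w i hi => ?_) hx, fun i a ha x => ?_⟩
  · rw [barLift_single, twist_of_mem k m (β.mem i), negOnePow_smul_smul, ← hi,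
      show β.deg i + β.wordDeg w + m = β.deg i + (m + β.wordDeg w) by ring]
    exact units_smul_mem _ _ (DGModule.smul_mem (β.mem i) (hy w))
  · rw [barLift_smul, twist_of_mem k m ha, negOnePow_smul_smul]

/-- This is where `R¹ = 0` matters for the bar resolution: each letter contributes at least `1` to
the degree of a word, so nonempty words have positive degree. -/
theorem two_le_deg (i : β.Letter) : 2 ≤ β.deg i.1 := by
  have hne := β.b.ne_zero
  have : Nontrivial R := hR.nontrivial
  have hi := β.mem i.1
  by_contra h
  rcases (by omega : β.deg i.1 < 0 ∨ β.deg i.1 = 0 ∨ β.deg i.1 = 1) with h | h | h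
  · rw [hR.gr_neg _ h] at hi
    exact hne _ hi
  · exact i.2 h
  · rw [h, hR.gr_one] at hi
    exact hne _ hi

theorem wordDeg_nonneg (w : List β.Letter) : 0 ≤ β.wordDeg w := by
  induction w with
  | nil => simp
  | cons i w ih =>
    have := β.two_le_deg i
    rw [wordDeg_cons]
    omega

theorem wordDeg_pos {w : List β.Letter} (hw : w ≠ []) : 0 < β.wordDeg w := by
  cases w with
  | nil => exact absurd rfl hw
  | cons i w =>
    have := β.two_le_deg i
    have := β.wordDeg_nonneg w
    rw [wordDeg_cons]
    omega

theorem barGr_neg {n : ℤ} (hn : n < 0) {x : β.Bar} (hx : x ∈ β.barGr n) : x = 0 := by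
  ext w
  have h := hx w
  have := β.wordDeg_nonneg w
  rw [hR.gr_neg _ (by omega)] at h
  exact h

theorem homGr_apply_eq_zero {n : ℤ} {f : β.Bar →ₗ[k] N} (hf : f ∈ homGr k R β.Bar N n) (x : β.Bar)
    (h : ∀ w, x w ≠ 0 → f (Finsupp.single w 1) = 0) : f x = 0 := by
  rw [← x.sum_single, map_finsuppSum]
  refine Finset.sum_eq_zero fun w hw => ?_
  have : (Finsupp.single w (x w) : β.Bar) = x w • Finsupp.single w 1 := by simp
  dsimp only
  rw [this, map_smul_of_mem_homGr hf, h w (Finsupp.mem_support_iff.1 hw), smul_zero]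

/-- Obstruction theory on the bar resolution: a cocycle is a coboundary if the obstructions
vanish, and the value of the homotopy at `[]` can be prescribed. -/
theorem exists_homotopy {n : ℤ} {f : β.Bar →ₗ[k] N} (hf : f ∈ homGr k R β.Bar N n)
    (hdf : homD k R β.Bar N n f = 0) {y₀ : N} (hy₀ : y₀ ∈ DGModule.gr (k := k) R (n - 1))
    (hdy₀ : DGModule.d (k := k) R y₀ = f (Finsupp.single [] 1))
    (hN : ∀ w, w ≠ [] → CycleVanish k R N (n + β.wordDeg w)) :
    ∃ h ∈ homGr k R β.Bar N (n - 1), homD k R β.Bar N (n - 1) h = f ∧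
      h (Finsupp.single [] 1) = y₀ := by
  obtain ⟨m, rfl⟩ : ∃ m, n = m + 1 := ⟨n - 1, by ring⟩
  rw [add_sub_cancel_right] at hy₀ ⊢
  -- The equation `d h - (-1)^m h d = f`, evaluated at `[w]` and solved for `d (h [w])`. Its
  -- right-hand side involves only the values of `h` on words occurring in `d [w]`, which have
  -- smaller weight.
  let p : (List β.Letter → N) → List β.Letter → N → Prop := fun y w z =>
    z ∈ DGModule.gr (k := k) R (m + β.wordDeg w) ∧ (w = [] → z = y₀) ∧
      (w ≠ [] → DGModule.d (k := k) R z = f (Finsupp.single w 1) +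
        m.negOnePow • β.barLift m y (β.dWord w))
  have hlow : ∀ w v, β.dWord w v ≠ 0 → β.weight v < β.weight w := fun w v h => by
    by_contra hv
    exact h ((β.dWord_weight w v).1 (not_lt.1 hv))
  -- Values are chosen before solvability is known, with default `0`; that every equation is
  -- solvable is proved afterwards, by induction on the weight.
  obtain ⟨y, hy⟩ := exists_recursive_choice β.weight p fun y y' w h z hz =>
    ⟨hz.1, hz.2.1, fun hw => by
      rw [hz.2.2 hw, β.barLift_congr m _ fun v hv => h v (hlow w v hv)]⟩
  have hygr : ∀ w, y w ∈ DGModule.gr (k := k) R (m + β.wordDeg w) := by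
    intro w
    by_cases h : ∃ z, p y w z
    · exact ((hy w).1 h).1
    · rw [(hy w).2 h]
      exact Submodule.zero_mem _
  have hy_nil : y [] = y₀ :=
    ((hy []).1 ⟨y₀, by simpa using hy₀, fun _ => rfl, fun h => absurd rfl h⟩).2.1 rfl
  let h := β.barLift m y
  have hh : h ∈ homGr k R β.Bar N m := β.barLift_mem hygr
  have hone : ∀ w, h (Finsupp.single w 1) = y w := fun w => by
    rw [β.barLift_single, map_one, one_smul]
  have hd : ∀ w, DGModule.d (k := k) R (Finsupp.single w 1 : β.Bar) = β.dWord w :=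
    β.barD_single_one
  have hD : homD k R β.Bar N m h - f ∈ homGr k R β.Bar N (m + 1) :=
    Submodule.sub_mem _ (homD_mem hh) hf
  have key : ∀ n w, β.weight w = n → (homD k R β.Bar N m h - f) (Finsupp.single w 1) = 0 := by
    intro n
    induction n using Nat.strong_induction_on with
    | _ n ih =>
      rintro w rfl
      rw [LinearMap.sub_apply, homD_apply, hd, hone]
      by_cases hw : w = []
      · subst hw
        rw [hy_nil, hdy₀, dWord, map_zero, smul_zero, sub_zero, sub_self]
      -- By induction the defect vanishes on the lighter words, hence on `d [w]`. Since `f` is a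
      -- cocycle, the right-hand side of the equation at `[w]` is then a cycle, and `hN` makes it a
      -- boundary.
      · have hx : (homD k R β.Bar N m h - f) (β.dWord w) = 0 :=
          β.homGr_apply_eq_zero hD _ fun v hv => ih _ (hlow w v hv) v rfl
        have hdd : DGModule.d (k := k) R (β.dWord w) = 0 := by
          rw [← hd, DGModule.d_d]
        rw [LinearMap.sub_apply, homD_apply, hdd, map_zero, smul_zero, sub_zero, sub_eq_zero] at hx
        have hdf' := LinearMap.congr_fun hdf (Finsupp.single w 1)
        rw [homD_apply, hd, LinearMap.zero_apply, sub_eq_zero] at hdf'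
        have hgr : (Finsupp.single w 1 : β.Bar) ∈ DGModule.gr (k := k) R (β.wordDeg w) :=
          β.single_mem_barGr w DGAlgebra.one_mem (zero_add _)
        obtain ⟨z, hz, hdz⟩ := hN w hw (f (Finsupp.single w 1) +
          m.negOnePow • β.barLift m y (β.dWord w)) (by
            rw [add_comm (m + 1)]
            refine Submodule.add_mem _ (hf.1 _ _ hgr) (units_smul_mem _ _ ?_)
            have := hh.1 _ _ (β.dWord_mem w)
            rwa [add_assoc, add_comm 1] at this) (by
            rw [map_add, map_negOnePow_smul, hdf', Int.negOnePow_succ]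
            change _ + m.negOnePow • DGModule.d (k := k) R (h (β.dWord w)) = 0
            rw [hx]
            simp)
        have hp := (hy w).1 ⟨z, by
          rwa [show m + 1 + β.wordDeg w - 1 = m + β.wordDeg w by ring] at hz,
          fun h => absurd h hw, fun _ => hdz⟩
        rw [hp.2.2 hw]
        simp [h]
  refine ⟨h, hh, sub_eq_zero.1 (LinearMap.ext fun x => ?_), (hone []).trans hy_nil⟩
  exact β.homGr_apply_eq_zero hD x fun w _ => key _ w rfl

/-- Words have degree `≥ 0`, so the obstructions to writing a cocycle of degree `n` as a coboundary
lie in `H^i(N)` with `i ≥ n`. This serves both for the upper end of the gap and for the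
`K`-projectivity of the bar resolution. -/
theorem homVanish_bar {n : ℤ} (hN : ∀ i, n ≤ i → CycleVanish k R N i) :
    HomVanish k R β.Bar N n := by
  intro f hf hdf
  have hgr : (Finsupp.single [] 1 : β.Bar) ∈ DGModule.gr (k := k) R 0 :=
    β.single_mem_barGr [] DGAlgebra.one_mem rfl
  have hdf' := LinearMap.congr_fun hdf (Finsupp.single [] 1)
  rw [homD_apply, show DGModule.d (k := k) R (Finsupp.single [] 1 : β.Bar) = 0 from
    β.barD_single_one [], map_zero, smul_zero, sub_zero] at hdf'
  obtain ⟨y, hy, hdy⟩ := hN n le_rfl _ (by simpa using hf.1 _ _ hgr) hdf'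
  obtain ⟨h, hh, hdh, -⟩ := β.exists_homotopy hf hdf hy hdy fun w _ => hN _ (by
    have := β.wordDeg_nonneg w
    omega)
  exact ⟨h, hh, hdh⟩

/-- A cycle `z` of degree `b` of a DG module without cohomology above degree `b + 1` is the image
of `[]` under a cocycle on the bar resolution. -/
theorem exists_homCocycle {b : ℤ} (hN : ∀ i, b + 1 < i → CycleVanish k R N i) {z : N}
    (hz : z ∈ DGModule.gr (k := k) R b) (hdz : DGModule.d (k := k) R z = 0) :
    ∃ φ : HomCocycle k R β.Bar N b, φ.1 (Finsupp.single [] 1) = z := by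
  -- A cocycle of degree `b` is a homotopy for the zero cochain of degree `b + 1`. Prescribing its
  -- value at `[]` leaves only obstructions at nonempty words, in degrees above `b + 1`.
  obtain ⟨h, hh, hdh, hz⟩ := β.exists_homotopy (n := b + 1) (f := 0) (y₀ := z)
    (Submodule.zero_mem _) (map_zero _) (by rwa [add_sub_cancel_right]) hdz
    fun w hw => hN _ (by
      have := β.wordDeg_pos hw
      omega)
  rw [add_sub_cancel_right] at hh hdh
  exact ⟨⟨h, hh, hdh⟩, hz⟩

end AdaptedBasis

/-! ### Cohomology of the cone of a map from the bar resolution -/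

section ConeCohomology

variable {k : Type u} {R : Type v} [Field k] [Ring R] [Algebra k R] [DGAlgebra k R]
  [hR : SimplyConnectedCochain k R] {β : AdaptedBasis k R}
  {L : Type*} [AddCommGroup L] [Module k L] [Module R L] [IsScalarTower k R L] [DGModule k R L]
  {b : ℤ} (φ : HomCocycle k R β.Bar L b)

theorem Cone.inl_add_mk (x x' : L) (y : β.Bar) :
    Cone.inl φ x + Cone.mk φ x' y = Cone.mk φ (x + x') y :=
  Prod.ext rfl (zero_add _)

theorem Cone.mk_eq_zero {x : L} {y : β.Bar} : Cone.mk φ x y = 0 ↔ x = 0 ∧ y = 0 := Prod.ext_iff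

/-- If `φ []` is not a boundary, then the inclusion of `L` into the cone of `φ` is surjective on
cohomology. -/
theorem Cone.exists_cycle
    (hφ : ¬ ∃ y ∈ DGModule.gr (k := k) R (b - 1),
      DGModule.d (k := k) R y = φ.1 (Finsupp.single [] 1)) {i : ℤ} {z : Cone φ}
    (hz : z ∈ DGModule.gr (k := k) R i) (hdz : DGModule.d (k := k) R z = 0) :
    ∃ x ∈ DGModule.gr (k := k) R i, DGModule.d (k := k) R x = 0 ∧
      ∃ y ∈ DGModule.gr (k := k) R (i - 1), z = Cone.inl φ x + DGModule.d (k := k) R y := by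
  induction z using Cone.cases with
  | h x p =>
  rw [Cone.mk_mem] at hz
  rw [Cone.d_mk, Cone.mk_eq_zero] at hdz
  obtain ⟨hx, hp⟩ := hz
  obtain ⟨hdx, hdp⟩ := hdz
  have hdp : β.barD p = 0 := by
    change _ • β.barD p = 0 at hdp
    rcases Int.units_eq_one_or (1 - b).negOnePow with h | h <;> simpa [h] using hdp
  -- Since the bar resolution resolves `k`, the cycle `p` is `c []` plus the boundary of its
  -- contraction.
  have hc := β.barD_contr p
  rw [hdp, map_zero, add_zero, eq_sub_iff_add_eq] at hc
  have hq := β.contr_mem hp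
  set q := β.contr p
  set e : β.Bar := Finsupp.single [] 1
  set c := augmentation k R (p [])
  have he : (Finsupp.single [] (algebraMap k R c) : β.Bar) = c • e := by
    simp [e, Algebra.algebraMap_eq_smul_one]
  rw [he] at hc
  have hφq : φ.1 q ∈ DGModule.gr (k := k) R i := by
    have := φ.2.1.1 _ q hq
    rwa [show i + (1 - b) - 1 + b = i by ring] at this
  have hdφq : DGModule.d (k := k) R (φ.1 q) = b.negOnePow • φ.1 (β.barD q) := φ.d_apply q
  have hx' : x - (1 - b).negOnePow • φ.1 q ∈ DGModule.gr (k := k) R i :=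
    Submodule.sub_mem _ hx (AdaptedBasis.units_smul_mem _ _ hφq)
  -- Removing the boundary part of `p` turns the cycle condition on the pair into: `c • φ []` is a
  -- boundary, up to sign.
  have hdx' : DGModule.d (k := k) R (x - (1 - b).negOnePow • φ.1 q) = -(c • φ.1 e) := by
    rw [map_sub, map_negOnePow_smul, hdφq, smul_smul, ← Int.negOnePow_add, sub_add_cancel,
      eq_neg_iff_add_eq_zero, ← map_smul φ.1 c, ← hdx, ← hc]
    simp only [map_add]
    simp
    abel
  have hc0 : c = 0 := by
    by_contra hne
    -- The component `p` has degree `i + 1 - b`, so a nonzero `c` needs this to be `0`. Then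
    -- dividing by `c` would make `φ []` a boundary, against `hφ`.
    have hi : i = b - 1 := by
      by_contra hi
      exact hne (augmentation_of_mem k R (n := i + (1 - b) - 0) (by omega) (hp []))
    subst hi
    refine hφ ⟨-(c⁻¹ • (x - (1 - b).negOnePow • φ.1 q)),
      Submodule.neg_mem _ (Submodule.smul_mem _ _ hx'), ?_⟩
    rw [map_neg, map_smul, hdx', smul_neg, neg_neg, smul_smul, inv_mul_cancel₀ hne, one_smul]
  rw [hc0, zero_smul, neg_zero] at hdx'
  rw [hc0, zero_smul, add_zero] at hc
  refine ⟨_, hx', hdx', Cone.mk φ 0 ((1 - b).negOnePow • q), (Cone.mk_mem φ).2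
    ⟨Submodule.zero_mem _, AdaptedBasis.units_smul_mem _ _ ?_⟩, ?_⟩
  · rw [sub_add_eq_add_sub]
    exact hq
  · rw [Cone.d_mk, Cone.inl_add_mk, map_zero, zero_add, map_negOnePow_smul, sub_add_cancel,
      map_negOnePow_smul, smul_smul, Int.units_mul_self, one_smul]
    exact congrArg _ hc.symm

end ConeCohomology

/-! ### Building a resolution of `k` by attaching cells to `R` -/

section Resolution

variable {k : Type u} {R : Type v} [Field k] [Ring R] [Algebra k R] [DGAlgebra k R]

/-- Evaluation at `1` identifies `Hom_R(R, M)` with `M`. -/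
theorem homVanish_self_algebra
    {M : Type*} [AddCommGroup M] [Module k M] [Module R M] [IsScalarTower k R M] [DGModule k R M]
    {n : ℤ} (hM : CycleVanish k R M n) : HomVanish k R R M n := by
  intro f hf hdf
  have h1 := LinearMap.congr_fun hdf 1
  rw [homD_apply, show DGModule.d (k := k) R (1 : R) = 0 from d_one, map_zero, smul_zero,
    sub_zero] at h1
  obtain ⟨y, hy, hdy⟩ := hM (f 1) (by simpa using hf.1 0 1 DGAlgebra.one_mem) h1
  let h : R →ₗ[k] M := (LinearMap.toSpanSingleton R M y).restrictScalars k ∘ₗ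
    (twist k R (n - 1)).toLinearMap
  have hh : h ∈ homGr k R R M (n - 1) := by
    refine ⟨fun j x hx => ?_, fun i a ha x => ?_⟩
    · change twist k R (n - 1) x • y ∈ _
      rw [twist_of_mem k _ hx, negOnePow_smul_smul]
      exact AdaptedBasis.units_smul_mem _ _ (DGModule.smul_mem hx hy)
    · change twist k R (n - 1) (a * x) • y = _ • a • twist k R (n - 1) x • y
      rw [map_mul, twist_of_mem k _ ha, mul_smul, negOnePow_smul_smul]
  refine ⟨h, hh, sub_eq_zero.1 (LinearMap.ext fun x => ?_)⟩
  have hD := Submodule.sub_mem _ (homD_mem' hh) hf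
  have hx : x = x • (1 : R) := by simp
  have hh1 : h 1 = y := by
    change twist k R (n - 1) 1 • y = y
    rw [map_one, one_smul]
  rw [hx, map_smul_of_mem_homGr hD, LinearMap.sub_apply, homD_apply, hh1, hdy,
    show DGModule.d (k := k) R (1 : R) = 0 from d_one, map_zero, smul_zero, sub_zero, sub_self,
    smul_zero, LinearMap.zero_apply]

variable (k R) in
/-- A DG module `L` in nonnegative degrees, `K`-projective, with `H⁰(L)` of dimension one and
`H¹(L) = 0`. -/
structure IsPartialResolution (L : Type v) [AddCommGroup L] [Module k L] [Module R L]
    [IsScalarTower k R L] [DGModule k R L] : Prop where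
  gr_neg : ∀ n < 0, ∀ x ∈ DGModule.gr (k := k) R (M := L) n, x = 0
  exists_unit : ∃ z ∈ DGModule.gr (k := k) R (M := L) 0, DGModule.d (k := k) R z = 0 ∧ z ≠ 0 ∧
    ∀ x ∈ DGModule.gr (k := k) R (M := L) 0, DGModule.d (k := k) R x = 0 → ∃ c : k, x = c • z
  one : CycleVanish k R L 1
  -- Test modules in the universe of `L` suffice: the property is only applied to a cone over `L`,
  -- and its null-homotopic identity then handles target modules in any universe.
  projective : ∀ (N : Type v) [AddCommGroup N] [Module k N] [Module R N] [IsScalarTower k R N]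
    [DGModule k R N], (∀ i, CycleVanish k R N i) → ∀ n, HomVanish k R L N n

variable (k R) in
/-- The cohomology of `L` in degree `i` is spanned by the classes of `m` cycles. -/
def SpannedByCycles (L : Type*) [AddCommGroup L] [Module k L] [Module R L]
    [IsScalarTower k R L] [DGModule k R L] (i : ℤ) (m : ℕ) : Prop :=
  ∃ s : Fin m → L,
    (∀ l, s l ∈ DGModule.gr (k := k) R i ∧ DGModule.d (k := k) R (s l) = 0) ∧
    ∀ x ∈ DGModule.gr (k := k) R i, DGModule.d (k := k) R x = 0 → ∃ c : Fin m → k,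
      ∃ y ∈ DGModule.gr (k := k) R (i - 1), x = ∑ l, c l • s l + DGModule.d (k := k) R y

variable [hR : SimplyConnectedCochain k R]

theorem isPartialResolution_self : IsPartialResolution k R R where
  gr_neg n hn x hx := by
    have hx : x ∈ DGAlgebra.gr (k := k) n := hx
    rwa [hR.gr_neg n hn] at hx
  exists_unit := by
    have := hR.nontrivial
    refine ⟨1, DGAlgebra.one_mem, d_one, one_ne_zero, fun x hx _ => ?_⟩
    have hx : x ∈ DGAlgebra.gr (k := k) 0 := hx
    rw [hR.gr_zero] at hx
    obtain ⟨c, rfl⟩ := hx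
    exact ⟨c, Algebra.algebraMap_eq_smul_one c⟩
  one x hx _ := by
    have hx : x ∈ DGAlgebra.gr (k := k) 1 := hx
    rw [hR.gr_one] at hx
    exact ⟨0, Submodule.zero_mem _, by rw [map_zero]; exact hx.symm⟩
  projective N _ _ _ _ _ hN n := homVanish_self_algebra (hN n)

variable {L : Type v} [AddCommGroup L] [Module k L] [Module R L] [IsScalarTower k R L]
  [DGModule k R L]

theorem SpannedByCycles.cycleVanish {i : ℤ} (h : SpannedByCycles k R L i 0) :
    CycleVanish k R L i := by
  obtain ⟨s, -, hs⟩ := h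
  intro x hx hdx
  obtain ⟨c, y, hy, rfl⟩ := hs x hx hdx
  exact ⟨y, hy, by simp⟩

variable {β : AdaptedBasis k R}

/-- The attached copy of the bar resolution starts in degree `b - 1 ≥ 1`, and the inclusion of `L`
is surjective on cohomology, so the conditions in degrees `≤ 1` survive. Projectivity passes to the
cone because the bar resolution has it. -/
theorem IsPartialResolution.cone (hL : IsPartialResolution k R L) {b : ℤ} (hb : 2 ≤ b)
    (φ : HomCocycle k R β.Bar L b)
    (hφ : ¬ ∃ y ∈ DGModule.gr (k := k) R (b - 1),
      DGModule.d (k := k) R y = φ.1 (Finsupp.single [] 1)) :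
    IsPartialResolution k R (Cone φ) where
  gr_neg n hn z hz := by
    induction z using Cone.cases with
    | h x p =>
    rw [Cone.mk_mem] at hz
    exact (Cone.mk_eq_zero φ).2 ⟨hL.gr_neg n hn x hz.1, β.barGr_neg (by omega) hz.2⟩
  exists_unit := by
    obtain ⟨z, hz, hdz, hne, hspan⟩ := hL.exists_unit
    refine ⟨Cone.inl φ z, (Cone.inl_isDGHom φ).map_mem 0 z hz, ?_, ?_, fun x hx hdx => ?_⟩
    · rw [← (Cone.inl_isDGHom φ).map_d, hdz, map_zero]
    · exact fun h => hne ((Cone.mk_eq_zero φ).1 h).1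
    · obtain ⟨x', hx', hdx', y, hy, rfl⟩ := Cone.exists_cycle φ hφ hx hdx
      obtain ⟨c, rfl⟩ := hspan x' hx' hdx'
      refine ⟨c, ?_⟩
      -- The correction `y` has degree `-1`, where both components of the cone are zero.
      have hy0 : y = 0 := by
        induction y using Cone.cases with
        | h y p =>
        rw [Cone.mk_mem] at hy
        exact (Cone.mk_eq_zero φ).2 ⟨hL.gr_neg _ (by norm_num) y hy.1,
          β.barGr_neg (by omega) hy.2⟩
      rw [hy0, map_zero, add_zero]
      exact map_smul ((Cone.inl φ).restrictScalars k) c z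
  one x hx hdx := by
    obtain ⟨x', hx', hdx', y, hy, rfl⟩ := Cone.exists_cycle φ hφ hx hdx
    obtain ⟨y', hy', rfl⟩ := hL.one x' hx' hdx'
    exact ⟨Cone.inl φ y' + y, Submodule.add_mem _ ((Cone.inl_isDGHom φ).map_mem _ _ hy') hy,
      by rw [map_add, (Cone.inl_isDGHom φ).map_d]⟩
  projective N _ _ _ _ _ hN n :=
    Cone.homVanish φ (hL.projective N hN n) (β.homVanish_bar fun i _ => hN i)

theorem Cone.spannedByCycles {b : ℤ} (φ : HomCocycle k R β.Bar L b)
    (hφ : ¬ ∃ y ∈ DGModule.gr (k := k) R (b - 1),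
      DGModule.d (k := k) R y = φ.1 (Finsupp.single [] 1)) {i : ℤ} {m : ℕ}
    (h : SpannedByCycles k R L i m) : SpannedByCycles k R (Cone φ) i m := by
  obtain ⟨s, hs, hspan⟩ := h
  refine ⟨fun l => Cone.inl φ (s l), fun l => ⟨(Cone.inl_isDGHom φ).map_mem _ _ (hs l).1, ?_⟩,
    fun x hx hdx => ?_⟩
  · rw [← (Cone.inl_isDGHom φ).map_d, (hs l).2, map_zero]
  · obtain ⟨x', hx', hdx', y, hy, rfl⟩ := Cone.exists_cycle φ hφ hx hdx
    obtain ⟨c, y', hy', rfl⟩ := hspan x' hx' hdx'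
    refine ⟨c, Cone.inl φ y' + y, Submodule.add_mem _ ((Cone.inl_isDGHom φ).map_mem _ _ hy') hy, ?_⟩
    rw [map_add, map_add, map_sum, (Cone.inl_isDGHom φ).map_d, add_assoc]
    congr 1
    exact Finset.sum_congr rfl fun l _ => map_smul ((Cone.inl φ).restrictScalars k) _ _

theorem d_mk_single {b : ℤ} (φ : HomCocycle k R β.Bar L b) :
    DGModule.d (k := k) R (Cone.mk φ 0 (Finsupp.single [] 1)) =
      Cone.inl φ (φ.1 (Finsupp.single [] 1)) := by
  rw [Cone.d_mk, map_zero, zero_add]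
  refine Prod.ext rfl ?_
  change (1 - b).negOnePow • β.barD (Finsupp.single [] 1) = 0
  rw [β.barD_single_one, AdaptedBasis.dWord, smul_zero]

theorem mk_single_mem {b : ℤ} (φ : HomCocycle k R β.Bar L b) :
    Cone.mk φ 0 (Finsupp.single [] 1) ∈ DGModule.gr (k := k) R (b - 1) :=
  (Cone.mk_mem φ).2 ⟨Submodule.zero_mem _, β.single_mem_barGr [] DGAlgebra.one_mem (by simp)⟩

/-- Attaching a cell along a cycle removes the class of this cycle. -/
theorem Cone.spannedByCycles_of_succ {b : ℤ} (φ : HomCocycle k R β.Bar L b)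
    (hφ : ¬ ∃ y ∈ DGModule.gr (k := k) R (b - 1),
      DGModule.d (k := k) R y = φ.1 (Finsupp.single [] 1)) {m : ℕ} {s : Fin (m + 1) → L}
    (hs : ∀ l, s l ∈ DGModule.gr (k := k) R b ∧ DGModule.d (k := k) R (s l) = 0)
    (hspan : ∀ x ∈ DGModule.gr (k := k) R b, DGModule.d (k := k) R x = 0 → ∃ c : Fin (m + 1) → k,
      ∃ y ∈ DGModule.gr (k := k) R (b - 1), x = ∑ l, c l • s l + DGModule.d (k := k) R y)
    (h0 : φ.1 (Finsupp.single [] 1) = s 0) : SpannedByCycles k R (Cone φ) b m := by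
  refine ⟨fun l => Cone.inl φ (s l.succ),
    fun l => ⟨(Cone.inl_isDGHom φ).map_mem _ _ (hs _).1, ?_⟩, fun x hx hdx => ?_⟩
  · rw [← (Cone.inl_isDGHom φ).map_d, (hs _).2, map_zero]
  · obtain ⟨x', hx', hdx', y, hy, rfl⟩ := Cone.exists_cycle φ hφ hx hdx
    obtain ⟨c, y', hy', rfl⟩ := hspan x' hx' hdx'
    refine ⟨fun l => c l.succ, c 0 • Cone.mk φ 0 (Finsupp.single [] 1) + (Cone.inl φ y' + y),
      Submodule.add_mem _ (Submodule.smul_mem _ _ (mk_single_mem φ))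
        (Submodule.add_mem _ ((Cone.inl_isDGHom φ).map_mem _ _ hy') hy), ?_⟩
    have hsm : ∀ (a : k) (x : L), Cone.inl φ (a • x) = a • Cone.inl φ x :=
      map_smul ((Cone.inl φ).restrictScalars k)
    rw [Fin.sum_univ_succ, map_add, map_add, map_sum, map_add, map_add,
      map_smul (DGModule.d (k := k) R), d_mk_single,
      (Cone.inl_isDGHom φ).map_d, h0, hsm]
    simp only [hsm]
    abel

variable {M : Type w} [AddCommGroup M] [Module k M] [Module R M] [IsScalarTower k R M]
  [DGModule k R M]

/-- Here `L` has only the cohomology `k`, generated by `z`. The bar resolution maps to `L` by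
sending `[]` to `z`, with acyclic cone. This cone is `K`-projective, hence contractible, so
vanishing of the cohomology of `Hom_R(-, M)` carries over from `L` to the bar resolution. -/
theorem homVanish_bar_of_resolution (hL : IsPartialResolution k R L)
    (hc : ∀ i, 1 < i → CycleVanish k R L i) {j : ℤ} (hM : HomVanish k R L M j) :
    HomVanish k R β.Bar M j := by
  obtain ⟨z, hz, hdz, hne, hspan⟩ := hL.exists_unit
  obtain ⟨φ, hφz⟩ := β.exists_homCocycle (b := 0) (fun i hi => hc i (by omega)) hz hdz
  have hφ : ¬ ∃ y ∈ DGModule.gr (k := k) R (0 - 1 : ℤ),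
      DGModule.d (k := k) R y = φ.1 (Finsupp.single [] 1) := by
    rintro ⟨y, hy, hdy⟩
    rw [hL.gr_neg _ (by norm_num) y hy, map_zero, hφz] at hdy
    exact hne hdy.symm
  have hC : ∀ i, CycleVanish k R (Cone φ) i := by
    intro i x hx hdx
    obtain ⟨x', hx', hdx', y, hy, rfl⟩ := Cone.exists_cycle φ hφ hx hdx
    suffices h : ∃ y' ∈ DGModule.gr (k := k) R (i - 1),
        DGModule.d (k := k) R y' = Cone.inl φ x' by
      obtain ⟨y', hy', hdy'⟩ := h
      exact ⟨y' + y, Submodule.add_mem _ hy' hy, by rw [map_add, hdy']⟩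
    -- Only the class of `z` needs the new cell, which bounds it; in the other degrees `L` is
    -- already acyclic.
    by_cases hi : i = 0
    · subst hi
      obtain ⟨c, rfl⟩ := hspan x' hx' hdx'
      refine ⟨c • Cone.mk φ 0 (Finsupp.single [] 1), Submodule.smul_mem _ _ (mk_single_mem φ), ?_⟩
      rw [map_smul, d_mk_single, hφz]
      exact (map_smul ((Cone.inl φ).restrictScalars k) c z).symm
    · have hv : CycleVanish k R L i := by
        rcases (by omega : i < 0 ∨ i = 1 ∨ 1 < i) with h | rfl | h
        · intro x hx _
          exact ⟨0, Submodule.zero_mem _, by rw [hL.gr_neg i h x hx, map_zero]⟩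
        · exact hL.one
        · exact hc i h
      obtain ⟨y', hy', rfl⟩ := hv x' hx' hdx'
      exact ⟨Cone.inl φ y', (Cone.inl_isDGHom φ).map_mem _ _ hy', by
        rw [(Cone.inl_isDGHom φ).map_d]⟩
  have hself : HomVanish k R (Cone φ) (Cone φ) 0 :=
    Cone.homVanish φ (hL.projective _ hC 0) (β.homVanish_bar fun i _ => hC i)
  -- For `b = 0` the shift is by `1`, so degree `j + 1` on the contractible cone gives degree `j` on
  -- the bar resolution.
  have := Cone.homVanish_right φ (n := j + 1) (by rwa [add_sub_cancel_right])
    (homVanish_of_homVanish_self (M := M) hself (j + 1))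
  rwa [show j + 1 - (1 - 0) = j by ring] at this

/-- If the cohomology of `L` in the degrees `2, …, b + 1` is finite dimensional, it can be killed
by attaching copies of the bar resolution. -/
theorem homVanish_bar_of_partialResolution {j : ℤ} (b : ℕ)
    (hbar : ∀ l : ℤ, j + 1 ≤ l → l ≤ j + b → HomVanish k R β.Bar M l) :
    ∀ (L : Type v) [AddCommGroup L] [Module k L] [Module R L] [IsScalarTower k R L]
      [DGModule k R L], IsPartialResolution k R L → (∀ i, ∃ m, SpannedByCycles k R L i m) →
      (∀ i, (b : ℤ) + 1 < i → CycleVanish k R L i) → HomVanish k R L M j →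
      HomVanish k R β.Bar M j := by
  induction b with
  | zero =>
    intro L _ _ _ _ _ hL _ hc hM
    exact homVanish_bar_of_resolution hL (by simpa using hc) hM
  | succ b ih =>
    have ih := ih fun l h1 h2 => hbar l h1 (by push_cast; omega)
    -- The top degree is now `b + 2`. An inner induction removes the spanning cycles in this degree
    -- one at a time, with `L` varying since each attachment replaces it by a cone.
    suffices h : ∀ (m : ℕ) (L : Type v) [AddCommGroup L] [Module k L] [Module R L]
        [IsScalarTower k R L] [DGModule k R L], IsPartialResolution k R L →
        (∀ i, ∃ m, SpannedByCycles k R L i m) → SpannedByCycles k R L (b + 2) m →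
        (∀ i, (b : ℤ) + 2 < i → CycleVanish k R L i) → HomVanish k R L M j →
        HomVanish k R β.Bar M j by
      intro L _ _ _ _ _ hL hs hc hM
      obtain ⟨m, hm⟩ := hs (b + 2)
      exact h m L hL hs hm (fun i hi => hc i (by push_cast; omega)) hM
    intro m
    induction m with
    | zero =>
      intro L _ _ _ _ _ hL hs hm hc hM
      refine ih L hL hs (fun i hi => ?_) hM
      rcases (by omega : i = b + 2 ∨ (b : ℤ) + 2 < i) with rfl | h
      · exact hm.cycleVanish
      · exact hc i h
    | succ m ihm =>
      intro L _ _ _ _ _ hL hs hm hc hM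
      obtain ⟨s, hscyc, hspan⟩ := hm
      obtain ⟨φ, hφz⟩ := β.exists_homCocycle (b := b + 2) (fun i hi => hc i (by omega))
        (hscyc 0).1 (hscyc 0).2
      -- A spanning cycle that is already a boundary is simply dropped; attaching a cell along it
      -- would create new cohomology.
      by_cases hφ : ∃ y ∈ DGModule.gr (k := k) R ((b : ℤ) + 2 - 1),
          DGModule.d (k := k) R y = φ.1 (Finsupp.single [] 1)
      · refine ihm L hL hs ⟨fun l => s l.succ, fun l => hscyc _, fun x hx hdx => ?_⟩ hc hM
        obtain ⟨y, hy, hdy⟩ := hφ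
        obtain ⟨c, y', hy', rfl⟩ := hspan x hx hdx
        refine ⟨fun l => c l.succ, c 0 • y + y',
          Submodule.add_mem _ (Submodule.smul_mem _ _ hy) hy', ?_⟩
        rw [Fin.sum_univ_succ, map_add, map_smul, hdy, hφz]
        abel
      · refine ihm (Cone φ) (hL.cone (by omega) φ hφ) (fun i => ?_)
          (Cone.spannedByCycles_of_succ φ hφ hscyc hspan hφz) (fun i hi => ?_)
          -- The cell of degree `b + 2` costs the vanishing in degree `j - (1 - (b + 2)) = j + b +
          -- 1`, the last one in the range of `hbar`.
          (Cone.homVanish φ hM (hbar _ (by omega) (by push_cast; omega)))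
        · obtain ⟨m, hm⟩ := hs i
          exact ⟨m, Cone.spannedByCycles φ hφ hm⟩
        · intro x hx hdx
          obtain ⟨x', hx', hdx', y, hy, rfl⟩ := Cone.exists_cycle φ hφ hx hdx
          obtain ⟨y', hy', rfl⟩ := hc i hi x' hx' hdx'
          exact ⟨Cone.inl φ y' + y, Submodule.add_mem _ ((Cone.inl_isDGHom φ).map_mem _ _ hy') hy,
            by rw [map_add, (Cone.inl_isDGHom φ).map_d]⟩

end Resolution

/-! ### Bass numbers and gaps -/

section Bass

variable {k : Type u} {R : Type v} [Field k] [Ring R] [Algebra k R] [DGAlgebra k R]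
  [hR : SimplyConnectedCochain k R]
  {M : Type w} [AddCommGroup M] [Module k M] [Module R M] [IsScalarTower k R M] [DGModule k R M]

theorem bassNumber_eq_zero_iff (n : ℤ) :
    bassNumber k R M n = 0 ↔ HomVanish k R (BarResolution k R) M n := by
  rw [bassNumber, rank_zero_iff, subsingleton_homCohomology_iff]

theorem bassNumber_eq_zero_of_le {n : ℤ} (h : ∀ i, n ≤ i → CycleVanish k R M i) :
    bassNumber k R M n = 0 :=
  (bassNumber_eq_zero_iff n).2 (AdaptedBasis.homVanish_bar _ h)

/-- If `g ≥ sup R`, then the degree just before a run of `g` vanishing Bass numbers supports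
cohomology as soon as it supports a Bass number. -/
theorem bassNumber_eq_zero_of_cycleVanish {j g : ℤ} (hg : ∀ i, g < i → CycleVanish k R R i)
    (hM : CycleVanish k R M j)
    (hgap : ∀ l : ℤ, j + 1 ≤ l → l ≤ j + g → bassNumber k R M l = 0) :
    bassNumber k R M j = 0 := by
  rw [bassNumber_eq_zero_iff]
  -- The cells have degrees `2, …, g` and use the Bass numbers in degrees `j + 1, …, j + g - 1`. For
  -- `g ≤ 1` the truncated value `0` is right: no cell is needed, as `H^i(R) = 0` for `i > 1`.
  refine homVanish_bar_of_partialResolution (g - 1).toNat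
    (fun l h1 h2 => (bassNumber_eq_zero_iff l).1 (hgap l h1 (by omega))) R
    isPartialResolution_self (fun i => ?_) (fun i hi => hg i (by omega))
    (homVanish_self_algebra hM)
  obtain ⟨m, s, hs, hspan⟩ := exists_spanning_cycles _ _ i (hR.locallyFinite i)
  exact ⟨m, s, hs, hspan⟩

theorem not_cycleVanish_iff {i : ℤ} :
    Nontrivial (Cohomology k R M i) ↔ ¬ CycleVanish k R M i := by
  rw [← not_subsingleton_iff_nontrivial, subsingleton_cohomology_iff]

theorem cycleVanish_of_sup_le {g i : ℤ} (h : sup k R M ≤ ((g : ℝ) : EReal)) (hi : g < i) :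
    CycleVanish k R M i := by
  by_contra hv
  have h1 : ((i : ℝ) : EReal) ≤ sup k R M := le_sSup ⟨i, not_cycleVanish_iff.2 hv, rfl⟩
  have h2 := h1.trans h
  rw [EReal.coe_le_coe_iff, Int.cast_le] at h2
  omega

/-- The lower end of the gap supports cohomology of `M` in degree `j` itself, the upper end in some
degree `≥ j + g + 1`. -/
theorem le_amp_of_hasBassGap {g : ℤ} (hg : sup k R R ≤ ((g : ℝ) : EReal))
    (h : HasBassGap k R M g) : (((g + 1 : ℤ) : ℝ) : EReal) ≤ amp k R M := by
  obtain ⟨j, hj, hgap, hj'⟩ := h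
  have h1 : ¬ CycleVanish k R M j := fun hM =>
    hj (bassNumber_eq_zero_of_cycleVanish (fun i => cycleVanish_of_sup_le hg) hM hgap)
  obtain ⟨i, hi, h2⟩ : ∃ i, j + g + 1 ≤ i ∧ ¬ CycleVanish k R M i := by
    by_contra hne
    push Not at hne
    exact hj' (bassNumber_eq_zero_of_le hne)
  have hinf : inf k R M ≤ ((j : ℝ) : EReal) := sInf_le ⟨j, not_cycleVanish_iff.2 h1, rfl⟩
  have hsup : ((i : ℝ) : EReal) ≤ sup k R M := le_sSup ⟨i, not_cycleVanish_iff.2 h2, rfl⟩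
  refine le_trans ?_ (EReal.sub_le_sub hsup hinf)
  rw [← EReal.coe_sub, EReal.coe_le_coe_iff, ← Int.cast_sub, Int.cast_le]
  omega

theorem inf_self_nonneg : 0 ≤ inf k R R := by
  refine le_sInf ?_
  rintro _ ⟨i, hi, rfl⟩
  by_contra h
  refine not_cycleVanish_iff.1 hi fun x hx _ => ?_
  have hx : x ∈ DGAlgebra.gr (k := k) i := hx
  have hi : i < 0 := by
    by_contra h'
    exact h (by exact_mod_cast (not_lt.1 h'))
  rw [hR.gr_neg i hi] at hx
  exact ⟨0, Submodule.zero_mem _, by rw [map_zero]; exact hx.symm⟩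

/-- As `R` lives in nonnegative degrees, its amplitude is at most `sup R ≤ g`, which is too small
for a gap of length `g`. -/
theorem not_hasBassGap_self {g : ℤ} (hg : sup k R R ≤ ((g : ℝ) : EReal)) :
    ¬ HasBassGap k R R g := by
  intro h
  have h1 := (le_amp_of_hasBassGap hg h).trans (EReal.sub_le_sub hg inf_self_nonneg)
  rw [sub_zero, EReal.coe_le_coe_iff, Int.cast_le] at h1
  omega

end Bass

end DG

theorem corollary4p11 (k : Type u) (R : Type v) [Field k] [Ring R] [Algebra k R]
    [DGAlgebra k R] [DG.SimplyConnectedCochain k R] (hsup : DG.sup k R R < ⊤) :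
    (∀ (M : Type w) [AddCommGroup M] [Module k M] [Module R M] [IsScalarTower k R M]
        [DGModule k R M],
      DG.LocallyFinite k R M → DG.IsBoundedAbove k R M →
      ∀ g : ℤ, DG.sup k R R ≤ ((g : ℝ) : EReal) → DG.HasBassGap k R M g →
        (((g + 1 : ℤ) : ℝ) : EReal) ≤ DG.amp k R M) ∧
    ∀ g : ℤ, DG.sup k R R ≤ ((g : ℝ) : EReal) → ¬ DG.HasBassGap k R R g := by
  exact ⟨fun _ _ _ _ _ _ _ _ _ hg hgap => DG.le_amp_of_hasBassGap hg hgap,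
    fun _ hg => DG.not_hasBassGap_self hg⟩
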